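/- Let $\bar{\mathbb N}^*=\{1,2,\dots\}\cup\{\infty\}$ be the one-point compactification of $\mathbb N^*=\{1,2,\dots\}$, with the metric $d(x,y)=|x^{-1}-y^{-1}|$ ($\infty^{-1}=0$). Let $\Pi$ be the space of càdlàg paths $[0,\infty)\to\bar{\mathbb N}^*$ with the σ-algebra generated by the coordinates, and for $u>0$ let $\Pi_u$ be the set of càdlàg paths $[0,u]\to\bar{\mathbb N}^*$; let $\hat\eta_{\infty,u}\in\Pi_u$ be the path identically equal to $\infty$. **The process.** Let $\gamma:\mathbb N^*\to(0,\infty)$ be fixed with $\sum_x\gamma(x)<\infty$. Let $N^{(x)}$, $x\in\mathbb N^*$, be independent Poisson processes of rate $1$ with event times $\sigma^{(x)}_1<\sigma^{(x)}_2<\dots$, and let $T^{(x)}_i$, $x\in\mathbb N^*$, $i\ge1$, be i.i.d. exponential random variables of rate $1$, independent of the Poisson processes. Put $\Gamma(s)=\sum_{x}\gamma(x)\sum_{i=1}^{N^{(x)}_s}T^{(x)}_i$. The $K(\gamma,0)$-process $Y$ started at $\infty$ is defined by $Y(t)=x$ if $\Gamma(\sigma^{(x)}_j-)\le t<\Gamma(\sigma^{(x)}_j)$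 for some $j\ge1$, and $Y(t)=\infty$ if there is no such $x\in\mathbb N^*$; almost surely it is a càdlàg path. Write $\mathbb E_\infty[\,\cdot\,|\gamma]$ for the expectation with respect to its law. **The functionals.** Let $\Phi:\mathbb R^+\times\mathbb R^+\times\Pi\to\mathbb R$ be such that $\Phi(t,t';\cdot)$ is measurable for all $t,t'>0$, and suppose that the following hold for some functions $\Psi_1:(0,\infty)\to\mathbb R$ and, for each $\theta>0$, $\Xi=\Xi_\theta:\{(x,s,\eta):x\in\mathbb N^*,\ 0<s<\theta,\ \eta\in\Pi_{\theta-s}\}\to\mathbb R$. 1. For all $t,t'>0$, $\Phi(t,t';\zeta)$ depends only on the restriction of $\zeta$ to $[t,t+t']$, and $\Phi(t,t';\zeta)=\Phi(1,t'/t;\zeta^t)$, where $\zeta^t(u)=\zeta(tu)$. 2. For $\theta>0$ and $x\in\mathbb N^*$: $\Phi(1,\theta;\zeta)=\Psi_1(\theta)$ whenever $\zeta\equiv x$ on $[1,1+\theta]$. 3. For $0<s<\theta$ and $x\in\mathbb N^*$: $\Phi(1,\theta;\zeta)=\Xi(x,s,\eta)$ whenever $\zeta\equiv x$ on $[1,1+s)$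 and $\zeta(1+s)\ne x$, where $\eta\in\Pi_{\theta-s}$ is the path $\eta(v)=\zeta(1+s+v)$. 4. For each $\theta>0$, $\Xi$ is uniformly bounded; $\Xi(x,s,\eta)=\Xi(y,s,\eta)$ whenever $\eta$ visits neither $x$ nor $y$; and for each $x\in\mathbb N^*$ the function $\eta\mapsto\Xi(x,s,\eta)$ is continuous at $\hat\eta_{\infty,\theta-s}$ in the sup norm (with respect to $d$), uniformly in $0<s<\theta$. 5. For $0<s<\theta$ let $\Psi_2(s,\theta)=\Xi(x,s,\hat\eta_{\infty,\theta-s})$, which by 4 does not depend on $x\in\mathbb N^*$. For every $\theta>0$ the limits $\Psi_2(0,\theta):=\lim_{s\downarrow0}\Psi_2(s,\theta)$ and $\Psi_2(\theta,\theta):=\lim_{s\uparrow\theta}\Psi_2(s,\theta)$ exist, and $s\mapsto\Psi_2(s,\theta)$ is differentiable on $(0,\theta)$ with $\partial_s\Psi_2(\cdot,\theta)\in L_1([0,\theta],ds)$. **Corollary 5.15.** Let $\Phi_1(t,t';\zeta)=1\{\zeta(s)=\zeta(t)\text{ for all }s\in[t,t+t']\}$ and suppose that for every $\theta>0$ the limit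 $$\Lambda(\theta)=\lim_{t\to0}\mathbb E_\infty[\Phi_1(t,\theta t;Y)\,|\,\gamma]$$ exists. Then, for every $\theta>0$, $\Phi(t,\theta t;Y)$ is integrable for every $t>0$, $\partial_s\Psi_2(\cdot,\theta)\Lambda$ is integrable on $[0,\theta]$, and $$\lim_{t\to0}\mathbb E_\infty[\Phi(t,\theta t;Y)\,|\,\gamma]=\Psi_2(0,\theta)+[\Psi_1(\theta)-\Psi_2(\theta,\theta)]\Lambda(\theta)+\int_0^\theta\partial_s\Psi_2(s,\theta)\Lambda(s)\,ds .$$ -/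

import Mathlib

open Set Filter Topology MeasureTheory ProbabilityTheory
open scoped NNReal ENNReal

noncomputable section

namespace KProc

/-! ### State space and path spaces -/

/-- The state space: the one-point compactification of the discrete space `{1, 2, …}`. -/
abbrev State : Type := OnePoint ℕ+

/-- The state space is countable and Hausdorff, so every subset is Borel. -/
instance instMeasurableSpaceState : MeasurableSpace State := ⊤

/-- `x ↦ 1 / x`, with `1 / ∞ = 0`. -/
def inv (x : State) : ℝ := OnePoint.elim x 0 (fun n : ℕ+ => ((n : ℕ) : ℝ)⁻¹)

/-- The metric `d(x, y) = |1/x - 1/y|` on the state space. -/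
def d (x y : State) : ℝ := |inv x - inv y|

/-- Right-continuous with left limits, for a function of a linearly ordered time. -/
def IsCadlag {T : Type} [TopologicalSpace T] [LinearOrder T] (f : T → State) : Prop :=
  ∀ t : T, ContinuousWithinAt f (Ici t) t ∧ ∃ l : State, Tendsto f (𝓝[<] t) (𝓝 l)

lemma isCadlag_const {T : Type} [TopologicalSpace T] [LinearOrder T] (x : State) :
    IsCadlag (fun _ : T => x) :=
  fun _ => ⟨continuousWithinAt_const, x, tendsto_const_nhds⟩

/-- A function obtained from a càdlàg one by a continuous strictly increasing change of time is
càdlàg. -/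
lemma IsCadlag.comp_strictMono {S T : Type} [TopologicalSpace S] [LinearOrder S]
    [TopologicalSpace T] [LinearOrder T] {f : T → State} (hf : IsCadlag f) {g : S → T}
    (hg : Continuous g) (hm : StrictMono g) : IsCadlag (fun s => f (g s)) := by
  intro s
  refine ⟨(hf (g s)).1.comp hg.continuousWithinAt (fun u hu => hm.monotone hu), ?_⟩
  obtain ⟨l, hl⟩ := (hf (g s)).2
  refine ⟨l, hl.comp ?_⟩
  exact tendsto_nhdsWithin_of_tendsto_nhds_of_eventually_within _
    (hg.continuousAt.tendsto.mono_left nhdsWithin_le_nhds)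
    (eventually_nhdsWithin_of_forall fun u hu => hm hu)

/-- The space of càdlàg paths `[0, ∞) → State`. As a subtype of a product it carries the
σ-algebra generated by the coordinate maps, which is the Borel σ-algebra of the Skorohod
topology. -/
abbrev CPath : Type := {f : ℝ≥0 → State // IsCadlag f}

/-- The space of càdlàg paths of length `u`, that is, càdlàg functions `[0, u] → State`. -/
abbrev Seg (u : ℝ≥0) : Type := {f : Icc (0 : ℝ≥0) u → State // IsCadlag f}

/-- The rescaled path `ζ^t(u) = ζ(t u)`. -/
def rescale (t : ℝ≥0) (ζ : CPath) : CPath :=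
  ⟨fun u => ζ.1 (t * u), by
    rcases eq_or_ne t 0 with rfl | ht
    · simpa using isCadlag_const (ζ.1 0)
    · exact ζ.2.comp_strictMono (by fun_prop)
        (fun a b hab => mul_lt_mul_of_pos_left hab (pos_iff_ne_zero.2 ht))⟩

/-- The piece of the path `ζ` on the time interval `[a, a + u]`, as a path of length `u`. -/
def piece (ζ : CPath) (a u : ℝ≥0) : Seg u :=
  ⟨fun v => ζ.1 (a + v), ζ.2.comp_strictMono (by fun_prop)
    (fun _ _ hvw => (add_lt_add_iff_left a).2 hvw)⟩

/-- The path of length `u` that is identically `∞`. -/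
def inftySeg (u : ℝ≥0) : Seg u := ⟨fun _ => OnePoint.infty, isCadlag_const _⟩

/-! ### The `K(γ, 0)`-process started at `∞` -/

/-- The sample space: `ω (Sum.inl (x, i))` is the `i`-th waiting time between successive events
of the Poisson process `N^(x)`, and `ω (Sum.inr (x, i))` is the holding time `T_i^(x)` attached to
its `i`-th event (events are numbered from `0`). -/
abbrev Clocks : Type := (ℕ+ × ℕ) ⊕ (ℕ+ × ℕ) → ℝ

instance instIsProbabilityMeasureExp : IsProbabilityMeasure (expMeasure 1) :=
  isProbabilityMeasure_expMeasure one_pos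

/-- All coordinates are independent exponential random variables of rate `1`; thus the
processes `N^(x)` are independent Poisson processes of rate `1`, independent of the holding times,
which are i.i.d. exponential of rate `1`. -/
def clockMeasure : Measure Clocks := Measure.infinitePi fun _ => expMeasure 1

/-- The time `σ_j^(x)` of the `j`-th event of the Poisson process `N^(x)`, where `p = (x, j)`. -/
def eventTime (ω : Clocks) (p : ℕ+ × ℕ) : ℝ := ∑ i ∈ Finset.range (p.2 + 1), ω (Sum.inl (p.1, i))

open Classical in
/-- `Γ(s) = ∑_x γ(x) ∑_{i : σ_i^(x) ≤ s} T_i^(x)`: the events `i` of `N^(x)` with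
`σ_i^(x) ≤ s` are exactly the first `N_s^(x)` ones. -/
def Gam (γ : ℕ+ → ℝ) (ω : Clocks) (s : ℝ) : ℝ≥0∞ :=
  ∑' p : ℕ+ × ℕ, if eventTime ω p ≤ s then ENNReal.ofReal (γ p.1 * ω (Sum.inr p)) else 0

open Classical in
/-- The left limit `Γ(s-) = ∑_x γ(x) ∑_{i : σ_i^(x) < s} T_i^(x)`. -/
def GamLeft (γ : ℕ+ → ℝ) (ω : Clocks) (s : ℝ) : ℝ≥0∞ :=
  ∑' p : ℕ+ × ℕ, if eventTime ω p < s then ENNReal.ofReal (γ p.1 * ω (Sum.inr p)) else 0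

open Classical in
/-- The `K(γ, 0)`-process started at `∞`: it is at `x ∈ {1, 2, …}` at time `t` if
`Γ(σ_j^(x)-) ≤ t < Γ(σ_j^(x))` for some `j` (almost surely there is at most one such pair
`(x, j)`), and at `∞` otherwise. -/
def kState (γ : ℕ+ → ℝ) (ω : Clocks) (t : ℝ≥0) : State :=
  if h : ∃ p : ℕ+ × ℕ, GamLeft γ ω (eventTime ω p) ≤ t ∧ (t : ℝ≥0∞) < Gam γ ω (eventTime ω p)
  then (h.choose.1 : State) else OnePoint.infty

open Classical in
/-- The `K(γ, 0)`-process started at `∞` as a random element of the path space. Its trajectories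
are almost surely càdlàg; the other realizations, a null event, are replaced by a constant path. -/
def kPath (γ : ℕ+ → ℝ) (ω : Clocks) : CPath :=
  if h : IsCadlag (kState γ ω) then ⟨kState γ ω, h⟩
  else ⟨fun _ => OnePoint.infty, isCadlag_const _⟩

/-- `E_∞[F(Y) | γ]`, where `Y` is the `K(γ, 0)`-process started at `∞`. -/
def expect (γ : ℕ+ → ℝ) (F : CPath → ℝ) : ℝ := ∫ ω, F (kPath γ ω) ∂clockMeasure

/-! ### Two-time functionals -/

open Classical in
/-- `Φ₁(t, t'; ζ) = 1{ζ(s) = ζ(t) for all s ∈ [t, t + t']}`. -/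
def noJump (t t' : ℝ≥0) (ζ : CPath) : ℝ := if ∀ s ∈ Icc t (t + t'), ζ.1 s = ζ.1 t then 1 else 0

/-- The class of two-time functionals `Φ`, together with the functions `Ψ₁`, `Ξ`, `Ψ₂` that go with
`Φ`. The states `x`, `y` range over the finite states `1, 2, …`. -/
structure IsTwoTimeFunctional (Φ : ℝ≥0 → ℝ≥0 → CPath → ℝ) (Ψ₁ : ℝ → ℝ)
    (Ξ : (θ : ℝ≥0) → ℕ+ → (s : ℝ≥0) → Seg (θ - s) → ℝ) (Ψ₂ : ℝ → ℝ → ℝ) : Prop where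
  /-- `Φ(t, t'; ·)` is a measurable function on path space. -/
  measurable : ∀ t t' : ℝ≥0, 0 < t → 0 < t' → Measurable (Φ t t')
  /-- `Φ(t, t'; ζ)` depends only on the restriction of `ζ` to `[t, t + t']`. -/
  localized : ∀ t t' : ℝ≥0, 0 < t → 0 < t' → ∀ ζ ζ' : CPath,
    (∀ u ∈ Icc t (t + t'), ζ.1 u = ζ'.1 u) → Φ t t' ζ = Φ t t' ζ'
  /-- `Φ(t, t'; ζ) = Φ(1, t'/t; ζ^t)`. -/
  scaling : ∀ t t' : ℝ≥0, 0 < t → 0 < t' → ∀ ζ : CPath, Φ t t' ζ = Φ 1 (t' / t) (rescale t ζ)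
  /-- `Φ(1, θ; ζ) = Ψ₁(θ)` if `ζ` is constant, equal to a finite state, on `[1, 1 + θ]`. -/
  constant : ∀ θ : ℝ≥0, 0 < θ → ∀ (x : ℕ+) (ζ : CPath),
    (∀ u ∈ Icc 1 (1 + θ), ζ.1 u = (x : State)) → Φ 1 θ ζ = Ψ₁ θ
  /-- `Φ(1, θ; ζ) = Ξ(x, s, η)` if, on `[1, 1 + θ]`, the path `ζ` is the concatenation of the path
  identically equal to `x` on `[1, 1 + s)` and of a piece `η` on `[1 + s, 1 + θ]` that does
  not start at `x`. -/
  firstJump : ∀ θ s : ℝ≥0, 0 < s → s < θ → ∀ (x : ℕ+) (ζ : CPath),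
    (∀ u ∈ Ico 1 (1 + s), ζ.1 u = (x : State)) → ζ.1 (1 + s) ≠ (x : State) →
      Φ 1 θ ζ = Ξ θ x s (piece ζ (1 + s) (θ - s))
  /-- `Ξ` is uniformly bounded, for each `θ`. -/
  bounded : ∀ θ : ℝ≥0, 0 < θ → ∃ C : ℝ, ∀ (x : ℕ+) (s : ℝ≥0) (η : Seg (θ - s)),
    0 < s → s < θ → |Ξ θ x s η| ≤ C
  /-- `Ξ(x, s, η) = Ξ(y, s, η)` if `η` visits neither `x` nor `y`. -/
  homogeneous : ∀ θ s : ℝ≥0, 0 < s → s < θ → ∀ (x y : ℕ+) (η : Seg (θ - s)),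
    (∀ u, η.1 u ≠ (x : State)) → (∀ u, η.1 u ≠ (y : State)) → Ξ θ x s η = Ξ θ y s η
  /-- `Ξ(x, s, ·)` is continuous in the sup norm at the path identically `∞`, uniformly in
  `0 < s < θ`. -/
  continuous : ∀ θ : ℝ≥0, 0 < θ → ∀ (x : ℕ+) (ε : ℝ), 0 < ε → ∃ δ : ℝ, 0 < δ ∧
    ∀ (s : ℝ≥0) (η : Seg (θ - s)), 0 < s → s < θ →
      (∀ u, d (η.1 u) ((inftySeg (θ - s)).1 u) < δ) →
        |Ξ θ x s η - Ξ θ x s (inftySeg (θ - s))| < ε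
  /-- For `0 < s < θ`, `Ψ₂(s, θ)` is the value of `Ξ(x, s, ·)` at the path identically `∞`. -/
  psi_eq : ∀ θ s : ℝ≥0, 0 < s → s < θ → ∀ x : ℕ+, Ψ₂ s θ = Ξ θ x s (inftySeg (θ - s))
  /-- `Ψ₂(0, θ)` is the limit of `Ψ₂(s, θ)` as `s ↓ 0`. -/
  psi_zero : ∀ θ : ℝ, 0 < θ → Tendsto (fun s => Ψ₂ s θ) (𝓝[>] 0) (𝓝 (Ψ₂ 0 θ))
  /-- `Ψ₂(θ, θ)` is the limit of `Ψ₂(s, θ)` as `s ↑ θ`. -/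
  psi_self : ∀ θ : ℝ, 0 < θ → Tendsto (fun s => Ψ₂ s θ) (𝓝[<] θ) (𝓝 (Ψ₂ θ θ))
  /-- `Ψ₂(·, θ)` is differentiable in `(0, θ)`. -/
  psi_diff : ∀ θ : ℝ, 0 < θ → ∀ s ∈ Ioo 0 θ, DifferentiableAt ℝ (fun r => Ψ₂ r θ) s
  /-- The derivative of `Ψ₂(·, θ)` is integrable on `[0, θ]`. -/
  psi_int : ∀ θ : ℝ, 0 < θ → IntervalIntegrable (deriv fun r => Ψ₂ r θ) volume 0 θ

end KProc

end

noncomputable section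

namespace KProc

/-! ### The exponential distribution -/

/-! Fix t > 0. Almost surely t lies in an excursion to a finite state x that ends at a time t(1 + a)
with a ≠ θ. If a > θ the functional equals Ψ₁(θ); if a < θ it equals Ξ(x, a, η), with η the rescaled
path after the excursion. For small t the path η stays near ∞, so Ξ(x, a, η) should be close to
Ψ₂(a, θ), and `surrogate` is the functional with this replacement made. Since Ψ₂(a, θ) = Ψ₂(0, θ) +
∫₀^θ ∂ₛΨ₂(s, θ) 1{s < a} ds, the surrogate is affine in the indicators 1{s < a}, whose expectations
are those of Φ₁(t, st; Y). Fubini (`integral_surrogate`) and dominated convergence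
(`tendsto_integral_surrogate`) yield the limit.

It remains to compare the two (`tendsto_expect_sub_surrogate`). Continuity of Ξ(x, s, ·) at ∞ is not
uniform in x, and x is random; but if η visits neither x nor 1, homogeneity replaces x by 1, and one
modulus of continuity suffices. Two bad events obstruct this. One is `earlyVisit`, whose probability
vanishes as t → 0. The other is `shortGap`: the next event of the clock of x follows within local
time δ. That gap is independent of the excursion found at t, so the probability is at most 1 -
exp(-δ), whatever t is (`clockMeasure_shortGap_le`). Off both events η stays above M and never
returns to x.

That a fixed time lies in an excursion (`ae_exists_covers`) holds because the uncovered times are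
Lebesgue null and resampling a holding time moves them by a continuous amount. Several independence
arguments take this resampling form, based on `map_update_clockMeasure`. -/

lemma expMeasure_Iic {x : ℝ} (hx : 0 ≤ x) :
    expMeasure 1 (Iic x) = ENNReal.ofReal (1 - Real.exp (-x)) := by
  have h := lintegral_exponentialPDF_eq_antiDeriv one_pos x
  rw [if_pos hx, one_mul] at h
  rw [← h, expMeasure, gammaMeasure, withDensity_apply _ measurableSet_Iic]
  rfl

lemma expMeasure_absolutelyContinuous : expMeasure 1 ≪ volume :=
  withDensity_absolutelyContinuous _ _

lemma expMeasure_ae_pos : ∀ᵐ u ∂expMeasure 1, 0 < u := by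
  rw [ae_iff]
  have : {u : ℝ | ¬ 0 < u} = Iic 0 := by ext; simp
  rw [this, expMeasure_Iic le_rfl]
  simp

lemma expMeasure_Iic_lt_one (x : ℝ) : expMeasure 1 (Iic x) < 1 := by
  refine (measure_mono (Iic_subset_Iic.2 (le_max_left x 0))).trans_lt ?_
  rw [expMeasure_Iic (le_max_right _ _), ← ENNReal.ofReal_one]
  exact (ENNReal.ofReal_lt_ofReal_iff one_pos).2 (by linarith [Real.exp_pos (-max x 0)])

lemma expMeasure_compl_Ioo_lt_one {a b : ℝ} (ha : 0 ≤ a) (hab : a < b) :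
    expMeasure 1 (Ioo a b)ᶜ < 1 := by
  rw [prob_compl_eq_one_sub measurableSet_Ioo]
  refine ENNReal.sub_lt_self ENNReal.one_ne_top one_ne_zero fun h => ?_
  obtain ⟨c, hac, hcb⟩ := exists_between hab
  have h1 : expMeasure 1 (Iic c) ≤ expMeasure 1 (Iic a) := by
    have : Iic c ⊆ Iic a ∪ Ioo a b := fun u hu => by
      rcases le_or_gt u a with h | h
      · exact Or.inl h
      · exact Or.inr ⟨h, lt_of_le_of_lt hu hcb⟩
    refine (measure_mono this).trans ((measure_union_le _ _).trans ?_)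
    rw [h, add_zero]
  rw [expMeasure_Iic ha, expMeasure_Iic (ha.trans hac.le)] at h1
  have h2 := (ENNReal.ofReal_le_ofReal_iff
    (by simp only [sub_nonneg, Real.exp_le_one_iff]; linarith)).1 h1
  have h3 : Real.exp (-c) < Real.exp (-a) := Real.exp_lt_exp.2 (by linarith)
  linarith

lemma lintegral_expMeasure_lt_top : ∫⁻ u, ENNReal.ofReal u ∂expMeasure 1 < ∞ := by
  have h0 : Measurable (gammaPDF 1 1) := (measurable_gammaPDFReal 1 1).ennreal_ofReal
  rw [expMeasure, gammaMeasure, lintegral_withDensity_eq_lintegral_mul _ h0 (by fun_prop)]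
  -- The mean is the integral defining the Gamma function at 2.
  have hint : IntegrableOn (fun x : ℝ => Real.exp (-x) * x ^ ((2 : ℝ) - 1)) (Ioi 0) :=
    Real.GammaIntegral_convergent two_pos
  refine lt_of_le_of_lt ?_ hint.lintegral_lt_top
  rw [← lintegral_indicator measurableSet_Ioi]
  refine lintegral_mono fun x => ?_
  by_cases hx : 0 < x
  · have := exponentialPDF_of_nonneg (r := 1) hx.le
    rw [indicator_of_mem (by exact hx)]
    change exponentialPDF 1 x * _ ≤ _
    rw [this, ← ENNReal.ofReal_mul (by positivity)]
    norm_num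
  · simp [ENNReal.ofReal_of_nonpos (not_lt.1 hx)]

/-! ### Resampling one clock -/

instance instIsProbabilityMeasureClockMeasure : IsProbabilityMeasure clockMeasure := by
  unfold clockMeasure; infer_instance

lemma measurable_update_clock (k : (ℕ+ × ℕ) ⊕ (ℕ+ × ℕ)) [DecidableEq ((ℕ+ × ℕ) ⊕ (ℕ+ × ℕ))] :
    Measurable fun q : Clocks × ℝ => Function.update q.1 k q.2 := by
  refine measurable_pi_iff.2 fun i => ?_
  rcases eq_or_ne i k with rfl | h
  · simpa using measurable_snd
  · simp only [Function.update_of_ne h]; fun_prop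

open Classical in
-- Replacing one coordinate by a fresh exponential preserves the law: the preimage of a box is a box
-- whose constraint at k is carried by the fresh variable. This allows conditioning on all other
-- clocks by Fubini.
lemma map_update_clockMeasure (k : (ℕ+ × ℕ) ⊕ (ℕ+ × ℕ)) :
    (clockMeasure.prod (expMeasure 1)).map (fun q => Function.update q.1 k q.2)
      = clockMeasure := by
  refine Measure.eq_infinitePi _ fun s t ht => ?_
  rw [Measure.map_apply (measurable_update_clock k) (.pi s.countable_toSet fun i _ => ht i)]
  have : (fun q : Clocks × ℝ => Function.update q.1 k q.2) ⁻¹' (Set.pi s t)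
      = Set.pi (s.erase k : Finset _) t ×ˢ (if k ∈ s then t k else univ) := by
    ext ⟨ω, u⟩
    simp only [mem_preimage, Set.mem_pi, mem_prod, Finset.coe_erase, Set.mem_sdiff, Finset.mem_coe,
      mem_singleton_iff]
    constructor
    · intro h
      refine ⟨fun i hi => ?_, ?_⟩
      · simpa [Function.update_of_ne hi.2] using h i hi.1
      · split_ifs with hk
        · simpa using h k hk
        · trivial
    · rintro ⟨h1, h2⟩ i hi
      rcases eq_or_ne i k with rfl | h
      · simpa [hi] using h2
      · simpa [Function.update_of_ne h] using h1 i ⟨hi, h⟩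
  rw [this, Measure.prod_prod, clockMeasure, Measure.infinitePi_pi _ fun i _ => ht i]
  split_ifs with hk
  · exact Finset.prod_erase_mul s (fun i => expMeasure 1 (t i)) hk
  · rw [Finset.erase_eq_of_notMem hk]; simp

open Classical in
/-- A measurable event is null as soon as, for almost every realization of the clocks, it is null
under resampling of one fixed clock. -/
lemma clockMeasure_eq_zero_of_update {F : Set Clocks} (hF : MeasurableSet F)
    (k : (ℕ+ × ℕ) ⊕ (ℕ+ × ℕ))
    (h : ∀ᵐ ω ∂clockMeasure, expMeasure 1 {u | Function.update ω k u ∈ F} = 0) :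
    clockMeasure F = 0 := by
  rw [← map_update_clockMeasure k, Measure.map_apply (measurable_update_clock k) hF,
    Measure.measure_prod_null (measurable_update_clock k hF)]
  exact h

open Classical in
lemma lintegral_clockMeasure_update {f : Clocks → ℝ≥0∞} (hf : Measurable f)
    (k : (ℕ+ × ℕ) ⊕ (ℕ+ × ℕ)) :
    ∫⁻ ω, f ω ∂clockMeasure
      = ∫⁻ ω, ∫⁻ u, f (Function.update ω k u) ∂expMeasure 1 ∂clockMeasure := by
  conv_lhs => rw [← map_update_clockMeasure k]
  rw [lintegral_map hf (measurable_update_clock k),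
    lintegral_prod _ (by exact (hf.comp (measurable_update_clock k)).aemeasurable)]

lemma map_eval_clockMeasure (k : (ℕ+ × ℕ) ⊕ (ℕ+ × ℕ)) :
    clockMeasure.map (fun ω => ω k) = expMeasure 1 :=
  Measure.infinitePi_map_eval _ k

lemma ae_clock_pos : ∀ᵐ ω ∂clockMeasure, ∀ k, 0 < ω k := by
  refine ae_all_iff.2 fun k => ?_
  have h := expMeasure_ae_pos
  rw [← map_eval_clockMeasure k] at h
  exact ae_of_ae_map (measurable_pi_apply k).aemeasurable h

lemma clockMeasure_forall_mem_le {k : ℕ → (ℕ+ × ℕ) ⊕ (ℕ+ × ℕ)} (hk : Function.Injective k)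
    {B : Set ℝ} (hB : MeasurableSet B) (n : ℕ) :
    clockMeasure {ω | ∀ j < n, ω (k j) ∈ B} = expMeasure 1 B ^ n := by
  classical
  have : {ω : Clocks | ∀ j < n, ω (k j) ∈ B}
      = Set.pi ((Finset.range n).image k : Finset _) (fun _ => B) := by
    ext ω; simp [Set.mem_pi]
  rw [this, clockMeasure, Measure.infinitePi_pi _ fun _ _ => hB, Finset.prod_const,
    Finset.card_image_of_injective _ hk, Finset.card_range]

lemma ae_exists_clock_notMem {k : ℕ → (ℕ+ × ℕ) ⊕ (ℕ+ × ℕ)} (hk : Function.Injective k)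
    {B : Set ℝ} (hB : MeasurableSet B) (h1 : expMeasure 1 B < 1) :
    ∀ᵐ ω ∂clockMeasure, ∃ j, ω (k j) ∉ B := by
  rw [ae_iff]
  push Not
  refine le_antisymm ?_ zero_le
  refine ge_of_tendsto' (ENNReal.tendsto_pow_atTop_nhds_zero_of_lt_one h1) fun n => ?_
  rw [← clockMeasure_forall_mem_le hk hB n]
  exact measure_mono fun ω hω j _ => hω j

/-! ### Excursions of the process -/

/-- The time `t` belongs to the excursion to `p.1` that is attached to the event `p`. -/
def Covers (γ : ℕ+ → ℝ) (ω : Clocks) (p : ℕ+ × ℕ) (t : ℝ≥0∞) : Prop :=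
  GamLeft γ ω (eventTime ω p) ≤ t ∧ t < Gam γ ω (eventTime ω p)

lemma gamLeft_mono (γ : ℕ+ → ℝ) (ω : Clocks) : Monotone (GamLeft γ ω) := fun s s' h => by
  refine ENNReal.tsum_le_tsum fun p => ?_
  split_ifs with h1 h2
  · exact le_rfl
  · exact absurd (h1.trans_le h) h2
  · exact zero_le
  · exact le_rfl

lemma gam_mono (γ : ℕ+ → ℝ) (ω : Clocks) : Monotone (Gam γ ω) := fun s s' h => by
  refine ENNReal.tsum_le_tsum fun p => ?_
  split_ifs with h1 h2
  · exact le_rfl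
  · exact absurd (h1.trans h) h2
  · exact zero_le
  · exact le_rfl

lemma gam_le_gamLeft (γ : ℕ+ → ℝ) (ω : Clocks) {s s' : ℝ} (h : s < s') :
    Gam γ ω s ≤ GamLeft γ ω s' := by
  refine ENNReal.tsum_le_tsum fun p => ?_
  split_ifs with h1 h2
  · exact le_rfl
  · exact absurd (h1.trans_lt h) h2
  · exact zero_le
  · exact le_rfl

lemma gamLeft_le_gam (γ : ℕ+ → ℝ) (ω : Clocks) (s : ℝ) : GamLeft γ ω s ≤ Gam γ ω s := by
  refine ENNReal.tsum_le_tsum fun p => ?_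
  split_ifs with h1 h2
  · exact le_rfl
  · exact absurd h1.le h2
  · exact zero_le
  · exact le_rfl

lemma gam_eventTime {γ : ℕ+ → ℝ} {ω : Clocks} (hinj : Function.Injective (eventTime ω))
    (p : ℕ+ × ℕ) : Gam γ ω (eventTime ω p)
      = GamLeft γ ω (eventTime ω p) + ENNReal.ofReal (γ p.1 * ω (Sum.inr p)) := by
  classical
  rw [← tsum_ite_eq p (fun q : ℕ+ × ℕ => ENNReal.ofReal (γ q.1 * ω (Sum.inr q))), Gam, GamLeft,
    ← ENNReal.tsum_add]
  refine tsum_congr fun q => ?_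
  rcases eq_or_ne q p with rfl | hq
  · simp
  · have : eventTime ω q ≠ eventTime ω p := fun h => hq (hinj h)
    simp [hq, le_iff_lt_or_eq, this]

/-- The properties of the clocks under which the complement of the excursions is null. -/
structure IsRegular (γ : ℕ+ → ℝ) (ω : Clocks) : Prop where
  nonneg : ∀ p, 0 ≤ ω (Sum.inr p)
  inj : Function.Injective (eventTime ω)
  fin : ∀ s, Gam γ ω s < ∞
  unbdd : ∀ t : ℝ≥0, ∃ s, (t : ℝ≥0∞) < Gam γ ω s

/-- The almost sure properties of the clocks that are needed. -/
structure IsGood (γ : ℕ+ → ℝ) (ω : Clocks) : Prop extends IsRegular γ ω where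
  pos : ∀ k, 0 < ω k
  locfin : ∀ x : ℕ+, ∀ s : ℝ, {j : ℕ | eventTime ω (x, j) ≤ s}.Finite
  dense : ∀ a b : ℝ, 0 ≤ a → a < b → ∃ p, a < eventTime ω p ∧ eventTime ω p < b

section Deterministic

variable {γ : ℕ+ → ℝ} {ω : Clocks}

lemma Covers.not_of_lt {p q : ℕ+ × ℕ} {t u : ℝ≥0∞} (hp : Covers γ ω p t) (hut : u ≤ t)
    (hlt : eventTime ω p < eventTime ω q) : ¬ Covers γ ω q u := fun hq =>
  absurd (hp.2.trans_le ((gam_le_gamLeft γ ω hlt).trans (hq.1.trans hut))) (lt_irrefl _)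

lemma Covers.unique (hinj : Function.Injective (eventTime ω)) {p q : ℕ+ × ℕ} {t : ℝ≥0∞}
    (hp : Covers γ ω p t) (hq : Covers γ ω q t) : p = q := by
  rcases lt_trichotomy (eventTime ω p) (eventTime ω q) with h | h | h
  · exact absurd hq (hp.not_of_lt le_rfl h)
  · exact hinj h
  · exact absurd hp (hq.not_of_lt le_rfl h)

lemma Covers.kState_eq (hinj : Function.Injective (eventTime ω)) {p : ℕ+ × ℕ} {t : ℝ≥0}
    (hp : Covers γ ω p t) : kState γ ω t = (p.1 : State) := by
  have h : ∃ p : ℕ+ × ℕ, GamLeft γ ω (eventTime ω p) ≤ t ∧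
    (t : ℝ≥0∞) < Gam γ ω (eventTime ω p) := ⟨p, hp⟩
  rw [kState, dif_pos h]
  have := Covers.unique hinj (p := h.choose) h.choose_spec hp
  rw [this]

lemma kState_eq_infty_iff {t : ℝ≥0} :
    kState γ ω t = OnePoint.infty ↔ ∀ p, ¬ Covers γ ω p t := by
  rw [kState]
  split_ifs with h
  · exact ⟨fun h' => absurd h' (OnePoint.coe_ne_infty _), fun h' => absurd h.choose_spec (h' _)⟩
  · exact ⟨fun _ p hp => h ⟨p, hp⟩, fun _ => rfl⟩

lemma kState_eq_coe_iff (hinj : Function.Injective (eventTime ω)) {t : ℝ≥0} {x : ℕ+} :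
    kState γ ω t = (x : State) ↔ ∃ j, Covers γ ω (x, j) t := by
  constructor
  · intro h
    have h' : ∃ p, Covers γ ω p t := by
      by_contra hc
      push Not at hc
      rw [kState_eq_infty_iff.2 hc] at h
      exact OnePoint.infty_ne_coe _ h
    obtain ⟨⟨y, j⟩, hp⟩ := h'
    have := hp.kState_eq hinj
    rw [this] at h
    obtain rfl : y = x := OnePoint.coe_injective h
    exact ⟨j, hp⟩
  · rintro ⟨j, hj⟩
    exact hj.kState_eq hinj

lemma IsGood.finite_start (h : IsGood γ ω) (x : ℕ+) (t : ℝ≥0) :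
    {j : ℕ | GamLeft γ ω (eventTime ω (x, j)) ≤ t}.Finite := by
  obtain ⟨s, hs⟩ := h.unbdd t
  refine (h.locfin x s).subset fun j hj => ?_
  by_contra hc
  exact absurd (hs.trans_le ((gam_le_gamLeft γ ω (not_le.1 hc)).trans hj)) (lt_irrefl _)

end Deterministic

/-! ### Trajectories are càdlàg -/

/-- Neighbourhoods of ∞ are the complements of finite sets of finite states. -/
lemma tendsto_infty_iff {α : Type*} {f : α → State} {l : Filter α} :
    Tendsto f l (𝓝 OnePoint.infty) ↔ ∀ x : ℕ+, ∀ᶠ u in l, f u ≠ (x : State) := by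
  constructor
  · intro h x
    exact h.eventually (isOpen_compl_singleton.mem_nhds (OnePoint.infty_ne_coe x))
  · intro h
    refine OnePoint.hasBasis_nhds_infty.tendsto_right_iff.2 ?_
    rintro s ⟨_, hs⟩
    have hfin : s.Finite := isCompact_iff_finite.1 hs
    filter_upwards [(hfin.eventually_all).2 fun x _ => h x] with u hu
    induction hfu : f u using OnePoint.rec with
    | infty => exact Or.inr rfl
    | coe y => exact Or.inl ⟨y, fun hy => hu y hy hfu, rfl⟩

/-- Finite states are isolated, so one-sided limits exist as soon as each indicator 1{f = x} is
eventually constant on each side; the limit is ∞ when all these constants are 0. -/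
lemma isCadlag_of_eventually {f : ℝ≥0 → State}
    (hr : ∀ (x : ℕ+) t, ∀ᶠ u in 𝓝[≥] t, (f u = (x : State) ↔ f t = (x : State)))
    (hl : ∀ (x : ℕ+) t, ∃ c : Prop, ∀ᶠ u in 𝓝[<] t, (f u = (x : State) ↔ c)) : IsCadlag f := by
  intro t
  constructor
  · rw [ContinuousWithinAt]
    induction hft : f t using OnePoint.rec with
    | infty =>
      refine tendsto_infty_iff.2 fun x => ?_
      filter_upwards [hr x t] with u hu h
      rw [hu.1 h] at hft
      exact OnePoint.coe_ne_infty _ hft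
    | coe y =>
      refine tendsto_const_nhds.congr' ?_
      filter_upwards [hr y t] with u hu
      exact (hu.2 hft).symm
  · choose c hc using fun x => hl x t
    by_cases h : ∃ x, c x
    · obtain ⟨x, hx⟩ := h
      refine ⟨x, tendsto_const_nhds.congr' ?_⟩
      filter_upwards [hc x] with u hu
      exact (hu.2 hx).symm
    · push Not at h
      refine ⟨OnePoint.infty, tendsto_infty_iff.2 fun x => ?_⟩
      filter_upwards [hc x] with u hu h'
      exact h x (hu.1 h')

lemma eventually_mem_Ico_right (a b : ℝ≥0∞) (t : ℝ≥0) :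
    ∀ᶠ u : ℝ≥0 in 𝓝[≥] t, ((a ≤ u ∧ (u : ℝ≥0∞) < b) ↔ (a ≤ t ∧ (t : ℝ≥0∞) < b)) := by
  have hc : Tendsto (fun u : ℝ≥0 => (u : ℝ≥0∞)) (𝓝[≥] t) (𝓝 t) :=
    (ENNReal.continuous_coe.tendsto t).mono_left nhdsWithin_le_nhds
  have h1 : ∀ᶠ u : ℝ≥0 in 𝓝[≥] t, (a ≤ u ↔ a ≤ t) := by
    rcases le_or_gt a t with h | h
    · filter_upwards [self_mem_nhdsWithin] with u hu
      exact iff_of_true (h.trans (by exact_mod_cast hu)) h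
    · filter_upwards [hc.eventually (gt_mem_nhds h)] with u hu
      exact iff_of_false hu.not_ge h.not_ge
  have h2 : ∀ᶠ u : ℝ≥0 in 𝓝[≥] t, ((u : ℝ≥0∞) < b ↔ (t : ℝ≥0∞) < b) := by
    rcases le_or_gt b t with h | h
    · filter_upwards [self_mem_nhdsWithin] with u hu
      have : (t : ℝ≥0∞) ≤ u := by exact_mod_cast hu
      exact iff_of_false (h.trans this).not_gt h.not_gt
    · filter_upwards [hc.eventually (gt_mem_nhds h)] with u hu
      exact iff_of_true hu h
  filter_upwards [h1, h2] with u hu1 hu2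
  rw [hu1, hu2]

lemma eventually_mem_Ico_left (a b : ℝ≥0∞) (t : ℝ≥0) :
    ∀ᶠ u : ℝ≥0 in 𝓝[<] t, ((a ≤ u ∧ (u : ℝ≥0∞) < b) ↔ (a < t ∧ (t : ℝ≥0∞) ≤ b)) := by
  have hc : Tendsto (fun u : ℝ≥0 => (u : ℝ≥0∞)) (𝓝[<] t) (𝓝 t) :=
    (ENNReal.continuous_coe.tendsto t).mono_left nhdsWithin_le_nhds
  have h1 : ∀ᶠ u : ℝ≥0 in 𝓝[<] t, (a ≤ u ↔ a < t) := by
    rcases lt_or_ge a t with h | h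
    · filter_upwards [hc.eventually (lt_mem_nhds h)] with u hu
      exact iff_of_true hu.le h
    · filter_upwards [self_mem_nhdsWithin] with u hu
      have : (u : ℝ≥0∞) < t := by exact_mod_cast hu
      exact iff_of_false (this.trans_le h).not_ge h.not_gt
  have h2 : ∀ᶠ u : ℝ≥0 in 𝓝[<] t, ((u : ℝ≥0∞) < b ↔ (t : ℝ≥0∞) ≤ b) := by
    rcases lt_or_ge b t with h | h
    · filter_upwards [hc.eventually (lt_mem_nhds h)] with u hu
      exact iff_of_false hu.le.not_gt h.not_ge
    · filter_upwards [self_mem_nhdsWithin] with u hu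
      have : (u : ℝ≥0∞) < t := by exact_mod_cast hu
      exact iff_of_true (this.trans_le h) h
  filter_upwards [h1, h2] with u hu1 hu2
  rw [hu1, hu2]

lemma IsGood.isCadlag {γ : ℕ+ → ℝ} {ω : Clocks} (h : IsGood γ ω) : IsCadlag (kState γ ω) := by
  have key : ∀ (x : ℕ+) (t : ℝ≥0), ∃ F : Set ℕ, F.Finite ∧
      ∀ᶠ u in 𝓝 t, (kState γ ω u = (x : State) ↔ ∃ j ∈ F, Covers γ ω (x, j) u) := by
    intro x t
    -- The horizon t + 1 makes one finite index set serve a whole neighbourhood of t.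
    refine ⟨_, h.finite_start x (t + 1), ?_⟩
    filter_upwards [gt_mem_nhds (lt_add_one t)] with u hu
    rw [kState_eq_coe_iff h.inj]
    refine exists_congr fun j => ⟨fun hj => ⟨hj.1.trans ?_, hj⟩, fun hj => hj.2⟩
    exact_mod_cast hu.le
  refine isCadlag_of_eventually (fun x t => ?_) fun x t => ?_
  · obtain ⟨F, hF, hk⟩ := key x t
    filter_upwards [nhdsWithin_le_nhds hk, (hF.eventually_all).2 fun j _ =>
      eventually_mem_Ico_right (GamLeft γ ω (eventTime ω (x, j))) (Gam γ ω (eventTime ω (x, j))) t]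
      with u hu1 hu2
    rw [hu1, hk.self_of_nhds]
    exact exists_congr fun j => and_congr_right fun hj => hu2 j hj
  · obtain ⟨F, hF, hk⟩ := key x t
    refine ⟨∃ j ∈ F, GamLeft γ ω (eventTime ω (x, j)) < t ∧ t ≤ Gam γ ω (eventTime ω (x, j)), ?_⟩
    filter_upwards [nhdsWithin_le_nhds hk, (hF.eventually_all).2 fun j _ =>
      eventually_mem_Ico_left (GamLeft γ ω (eventTime ω (x, j))) (Gam γ ω (eventTime ω (x, j))) t]
      with u hu1 hu2
    rw [hu1]
    exact exists_congr fun j => and_congr_right fun hj => hu2 j hj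

/-! ### The complement of the excursions -/

/-- The times that belong to no excursion. -/
def uncovered (γ : ℕ+ → ℝ) (ω : Clocks) : Set ℝ :=
  {t | 0 ≤ t ∧ ∀ p, ¬ Covers γ ω p (ENNReal.ofReal t)}

open Classical in
-- The excursions up to local time s are disjoint intervals inside [0, Γ(s)), and their lengths add
-- up to Γ(s), because Γ is a pure sum of jumps without drift. Nothing of positive measure is left.
lemma IsRegular.volume_uncovered {γ : ℕ+ → ℝ} {ω : Clocks} (h : IsRegular γ ω) :
    volume (uncovered γ ω) = 0 := by
  have hfinL : ∀ s, GamLeft γ ω s ≠ ∞ := fun s => ((gamLeft_le_gam γ ω s).trans_lt (h.fin s)).ne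
  have key : ∀ n : ℕ, volume (uncovered γ ω ∩ Iio (n : ℝ)) = 0 := by
    intro n
    obtain ⟨s, hs⟩ := h.unbdd n
    let I : ℕ+ × ℕ → Set ℝ := fun p => if eventTime ω p ≤ s then
      Ico (GamLeft γ ω (eventTime ω p)).toReal (Gam γ ω (eventTime ω p)).toReal else ∅
    have hI : ∀ p t, 0 ≤ t → (t ∈ I p ↔ eventTime ω p ≤ s ∧ Covers γ ω p (ENNReal.ofReal t)) := by
      intro p t ht
      simp only [I, Covers]
      split_ifs with hp
      · rw [mem_Ico, ENNReal.le_ofReal_iff_toReal_le (hfinL _) ht,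
          ENNReal.ofReal_lt_iff_lt_toReal ht (h.fin _).ne]
        simp [hp]
      · simp [hp]
    have hI0 : ∀ p t, t ∈ I p → 0 ≤ t := by
      intro p t ht
      simp only [I] at ht
      split_ifs at ht with hp
      · exact ENNReal.toReal_nonneg.trans ht.1
      · exact absurd ht (notMem_empty t)
    have hm : ∀ p, MeasurableSet (I p) := by
      intro p
      simp only [I]
      split_ifs
      · exact measurableSet_Ico
      · exact MeasurableSet.empty
    have hdisj : Pairwise (Function.onFun Disjoint I) := by
      intro p q hpq
      refine Set.disjoint_left.2 fun t htp htq => hpq ?_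
      have h0 := hI0 p t htp
      exact Covers.unique h.inj ((hI p t h0).1 htp).2 ((hI q t h0).1 htq).2
    have hvol : volume (⋃ p, I p) = Gam γ ω s := by
      rw [measure_iUnion hdisj hm, Gam]
      refine tsum_congr fun p => ?_
      simp only [I]
      split_ifs with hp
      · rw [Real.volume_Ico, gam_eventTime h.inj, ENNReal.toReal_add (hfinL _) ENNReal.ofReal_ne_top,
          add_sub_cancel_left, ENNReal.ofReal_toReal ENNReal.ofReal_ne_top]
      · simp
    have hsub : (⋃ p, I p) ⊆ Ico 0 (Gam γ ω s).toReal := by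
      refine iUnion_subset fun p t ht => ?_
      have h0 := hI0 p t ht
      obtain ⟨h1, h2⟩ := (hI p t h0).1 ht
      refine ⟨h0, (ENNReal.ofReal_lt_iff_lt_toReal h0 (h.fin _).ne).1 ?_⟩
      exact h2.2.trans_le (gam_mono γ ω h1)
    have hzero : volume (Ico 0 (Gam γ ω s).toReal \ ⋃ p, I p) = 0 := by
      rw [measure_sdiff hsub (MeasurableSet.iUnion hm).nullMeasurableSet
        (by rw [hvol]; exact (h.fin s).ne), hvol, Real.volume_Ico, sub_zero,
        ENNReal.ofReal_toReal (h.fin s).ne, tsub_self]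
    refine measure_mono_null ?_ hzero
    rintro t ⟨⟨ht0, ht⟩, htn⟩
    refine ⟨⟨ht0, ?_⟩, fun hc => ?_⟩
    · refine lt_trans htn ?_
      have := (ENNReal.toReal_lt_toReal ENNReal.coe_ne_top (h.fin s).ne).2 hs
      simpa using this
    · obtain ⟨p, hp⟩ := mem_iUnion.1 hc
      exact ht p ((hI p t ht0).1 hp).2
  refine measure_mono_null ?_ (measure_iUnion_null key)
  intro t ht
  obtain ⟨n, hn⟩ := exists_nat_gt t
  exact mem_iUnion.2 ⟨n, ht, hn⟩

/-! ### Resampling one holding time -/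

section Shift

variable [DecidableEq ((ℕ+ × ℕ) ⊕ (ℕ+ × ℕ))]

@[simp] lemma eventTime_update_inr (ω : Clocks) (m : ℕ+ × ℕ) (u : ℝ) :
    eventTime (Function.update ω (Sum.inr m) u) = eventTime ω := by
  ext p
  simp [eventTime]

open Classical in
lemma gam_update_inr (γ : ℕ+ → ℝ) (ω : Clocks) (m : ℕ+ × ℕ) (u s : ℝ) :
    Gam γ (Function.update ω (Sum.inr m) u) s = Gam γ (Function.update ω (Sum.inr m) 0) s
      + if eventTime ω m ≤ s then ENNReal.ofReal (γ m.1 * u) else 0 := by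
  rw [← tsum_ite_eq m (fun q : ℕ+ × ℕ =>
    if eventTime ω q ≤ s then ENNReal.ofReal (γ q.1 * u) else 0), Gam, Gam, ← ENNReal.tsum_add]
  refine tsum_congr fun q => ?_
  rcases eq_or_ne q m with rfl | hq
  · simp
  · simp [hq]

open Classical in
lemma gamLeft_update_inr (γ : ℕ+ → ℝ) (ω : Clocks) (m : ℕ+ × ℕ) (u s : ℝ) :
    GamLeft γ (Function.update ω (Sum.inr m) u) s = GamLeft γ (Function.update ω (Sum.inr m) 0) s
      + if eventTime ω m < s then ENNReal.ofReal (γ m.1 * u) else 0 := by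
  rw [← tsum_ite_eq m (fun q : ℕ+ × ℕ =>
    if eventTime ω q < s then ENNReal.ofReal (γ q.1 * u) else 0), GamLeft, GamLeft,
    ← ENNReal.tsum_add]
  refine tsum_congr fun q => ?_
  rcases eq_or_ne q m with rfl | hq
  · simp
  · simp [hq]

/-- Setting the holding time of m to 0 moves every later excursion left by γ(m.1) u, while the
excursions up to m are over by the shifted time. -/
lemma sub_mem_uncovered_update {γ : ℕ+ → ℝ} {ω : Clocks} {m : ℕ+ × ℕ} {u t : ℝ}
    (hu : 0 ≤ γ m.1 * u) (ht : t ∈ uncovered γ (Function.update ω (Sum.inr m) u))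
    (hmt : Gam γ (Function.update ω (Sum.inr m) u) (eventTime ω m) ≤ ENNReal.ofReal t) :
    t - γ m.1 * u ∈ uncovered γ (Function.update ω (Sum.inr m) 0) := by
  obtain ⟨ht0, ht⟩ := ht
  rw [gam_update_inr, if_pos le_rfl] at hmt
  have hle : γ m.1 * u ≤ t :=
    (ENNReal.ofReal_le_ofReal_iff ht0).1 (le_add_self.trans hmt)
  have hsplit : ENNReal.ofReal t = ENNReal.ofReal (t - γ m.1 * u) + ENNReal.ofReal (γ m.1 * u) := by
    rw [← ENNReal.ofReal_add (by linarith) hu, sub_add_cancel]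
  rw [hsplit] at hmt
  have hmt' := (ENNReal.add_le_add_iff_right ENNReal.ofReal_ne_top).1 hmt
  refine ⟨by linarith, fun q hq => ?_⟩
  simp only [Covers, eventTime_update_inr] at hq
  rcases le_or_gt (eventTime ω q) (eventTime ω m) with h | h
  · exact absurd (hq.2.trans_le ((gam_mono _ _ h).trans hmt')) (lt_irrefl _)
  · refine ht q ?_
    simp only [Covers, eventTime_update_inr]
    rw [gam_update_inr, gamLeft_update_inr, if_pos h, if_pos h.le, hsplit]
    exact ⟨add_le_add_left hq.1 _, ENNReal.add_lt_add_right ENNReal.ofReal_ne_top hq.2⟩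

/-- A zero holding time breaks the strict positivity in `IsGood`; this is why `IsRegular` asks only
for nonnegativity. -/
lemma IsRegular.update_zero {γ : ℕ+ → ℝ} {ω : Clocks} (h : IsRegular γ ω) (m : ℕ+ × ℕ) :
    IsRegular γ (Function.update ω (Sum.inr m) 0) := by
  have hG : ∀ s, Gam γ (Function.update ω (Sum.inr m) 0) s ≤ Gam γ ω s ∧ Gam γ ω s ≤
      Gam γ (Function.update ω (Sum.inr m) 0) s + ENNReal.ofReal (γ m.1 * ω (Sum.inr m)) := by
    intro s
    have := gam_update_inr γ ω m (ω (Sum.inr m)) s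
    rw [Function.update_eq_self] at this
    rw [this]
    refine ⟨le_self_add, add_le_add_right ?_ _⟩
    split_ifs
    · exact le_rfl
    · exact zero_le
  refine ⟨fun p => ?_, ?_, fun s => (hG s).1.trans_lt (h.fin s), fun t => ?_⟩
  · rcases eq_or_ne p m with rfl | hp
    · simp
    · simpa [hp] using h.nonneg p
  · rw [eventTime_update_inr]
    exact h.inj
  · obtain ⟨s, hs⟩ := h.unbdd (t + (γ m.1 * ω (Sum.inr m)).toNNReal)
    refine ⟨s, ?_⟩
    have := hs.trans_le (hG s).2
    rw [ENNReal.coe_add] at this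
    exact lt_of_add_lt_add_right this

end Shift

/-! ### Measurability -/

@[fun_prop]
lemma measurable_eventTime (p : ℕ+ × ℕ) : Measurable fun ω => eventTime ω p := by
  unfold eventTime; fun_prop

lemma measurable_gam (γ : ℕ+ → ℝ) {f : Clocks → ℝ} (hf : Measurable f) :
    Measurable fun ω => Gam γ ω (f ω) := by
  unfold Gam
  refine Measurable.tsum fun p => ?_
  exact Measurable.ite (measurableSet_le (measurable_eventTime p) hf) (by fun_prop) (by fun_prop)

lemma measurable_gamLeft (γ : ℕ+ → ℝ) {f : Clocks → ℝ} (hf : Measurable f) :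
    Measurable fun ω => GamLeft γ ω (f ω) := by
  unfold GamLeft
  refine Measurable.tsum fun p => ?_
  exact Measurable.ite (measurableSet_lt (measurable_eventTime p) hf) (by fun_prop) (by fun_prop)

lemma measurableSet_covers (γ : ℕ+ → ℝ) (p : ℕ+ × ℕ) (t : ℝ≥0∞) :
    MeasurableSet {ω | Covers γ ω p t} :=
  (measurableSet_le (measurable_gamLeft γ (measurable_eventTime p)) measurable_const).inter
    (measurableSet_lt measurable_const (measurable_gam γ (measurable_eventTime p)))

/-! ### A fixed time belongs to an excursion -/

/-- If t is uncovered and follows the excursion m, resample the holding time u of m: t - γ(m.1) u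
must fall in a null set that does not depend on u, which has probability 0. It remains to exclude
that t precedes the end of every excursion. -/
lemma ae_exists_covers {γ : ℕ+ → ℝ} (hγ : ∀ x, 0 < γ x)
    (hreg : ∀ᵐ ω ∂clockMeasure, IsRegular γ ω) {t : ℝ≥0} (ht : 0 < t) :
    ∀ᵐ ω ∂clockMeasure, ∃ p, Covers γ ω p t := by
  classical
  have hF : ∀ m, clockMeasure {ω | (∀ p, ¬ Covers γ ω p t) ∧ Gam γ ω (eventTime ω m) ≤ t} = 0 := by
    intro m
    refine clockMeasure_eq_zero_of_update ?_ (Sum.inr m) ?_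
    · have he : {ω | ∀ p, ¬ Covers γ ω p t} = ⋂ p, {ω | Covers γ ω p t}ᶜ := by
        ext ω; simp
      have hm1 : MeasurableSet {ω | ∀ p, ¬ Covers γ ω p t} := by
        rw [he]
        exact MeasurableSet.iInter fun p => (measurableSet_covers γ p t).compl
      exact hm1.inter (measurableSet_le (measurable_gam γ (measurable_eventTime m)) measurable_const)
    · filter_upwards [hreg] with ω hω
      have hnull := (hω.update_zero m).volume_uncovered
      have h2 : volume {u : ℝ | (t : ℝ) + (-γ m.1) * u ∈
          uncovered γ (Function.update ω (Sum.inr m) 0)} = 0 := by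
        have := Real.volume_preimage_mul_left (neg_ne_zero.2 (hγ m.1).ne')
          ((fun v => (t : ℝ) + v) ⁻¹' uncovered γ (Function.update ω (Sum.inr m) 0))
        rw [measure_preimage_add, hnull, mul_zero] at this
        exact this
      refine measure_mono_null ?_
        (measure_union_null (ae_iff.1 expMeasure_ae_pos) (expMeasure_absolutelyContinuous h2))
      rintro u ⟨hu1, hu2⟩
      rcases le_or_gt u 0 with h | h
      · exact Or.inl h.not_gt
      · right
        have := sub_mem_uncovered_update (t := t) (mul_nonneg (hγ m.1).le h.le)
          ⟨t.2, fun p hp => hu1 p (by simpa using hp)⟩ (by simpa using hu2)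
        rw [sub_eq_add_neg, ← neg_mul] at this
        exact this
  have hall : ∀ᵐ ω ∂clockMeasure, ∀ m,
      ¬ ((∀ p, ¬ Covers γ ω p t) ∧ Gam γ ω (eventTime ω m) ≤ t) :=
    ae_all_iff.2 fun m => by
      rw [ae_iff]
      simpa only [not_not] using hF m
  filter_upwards [hreg, hall] with ω hω hm
  by_contra hc
  push Not at hc
  have hlt : ∀ m, (t : ℝ≥0∞) < Gam γ ω (eventTime ω m) := fun m =>
    not_le.1 fun h => hm m ⟨hc, h⟩
  -- An excursion containing u < t would also contain t, since each one ends after t; so [0, t)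
  -- would be uncovered, against nullity.
  have hsub : Ico (0 : ℝ) t ⊆ uncovered γ ω := by
    refine fun u hu => ⟨hu.1, fun p hp => hc p ⟨hp.1.trans ?_, hlt p⟩⟩
    exact ENNReal.ofReal_le_of_le_toReal hu.2.le
  have := measure_mono_null hsub hω.volume_uncovered
  rw [Real.volume_Ico, ENNReal.ofReal_eq_zero] at this
  have h0 : (0 : ℝ) < t := ht
  linarith

/-! ### Almost sure properties of the clocks -/

lemma eventTime_strictMono {ω : Clocks} (h : ∀ k, 0 < ω k) (x : ℕ+) :
    StrictMono fun j => eventTime ω (x, j) := by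
  refine strictMono_nat_of_lt_succ fun j => ?_
  simp only [eventTime]
  rw [Finset.sum_range_succ _ (j + 1)]
  exact lt_add_of_pos_right _ (h _)

lemma clock_le_eventTime {ω : Clocks} (h : ∀ k, 0 < ω k) {p : ℕ+ × ℕ} {i : ℕ} (hi : i ≤ p.2) :
    ω (Sum.inl (p.1, i)) ≤ eventTime ω p :=
  Finset.single_le_sum (f := fun i => ω (Sum.inl (p.1, i))) (fun _ _ => (h _).le)
    (Finset.mem_range.2 (Nat.lt_succ_of_le hi))

lemma eventTime_pos {ω : Clocks} (h : ∀ k, 0 < ω k) (p : ℕ+ × ℕ) : 0 < eventTime ω p :=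
  (h _).trans_le (clock_le_eventTime h le_rfl)

lemma eventTime_update_inl [DecidableEq ((ℕ+ × ℕ) ⊕ (ℕ+ × ℕ))] (ω : Clocks) {p q : ℕ+ × ℕ}
    (h : q.1 ≠ p.1 ∨ q.2 < p.2) (u : ℝ) :
    eventTime (Function.update ω (Sum.inl p) u) q = eventTime ω q := by
  refine Finset.sum_congr rfl fun i hi => Function.update_of_ne ?_ _ _
  rw [Finset.mem_range] at hi
  intro he
  obtain rfl := Sum.inl_injective he
  rcases h with h | h
  · exact h rfl
  · simp only at h; omega

/-- Given all other clocks, a tie between two different Poisson processes forces the last gap before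
p to take a single value; within one process the event times increase strictly. -/
lemma ae_injective_eventTime : ∀ᵐ ω ∂clockMeasure, Function.Injective (eventTime ω) := by
  classical
  have key : ∀ p q : ℕ+ × ℕ, p.1 ≠ q.1 → ∀ᵐ ω ∂clockMeasure, eventTime ω p ≠ eventTime ω q := by
    intro p q hpq
    rw [ae_iff]
    simp only [not_not]
    refine clockMeasure_eq_zero_of_update
      (measurableSet_eq_fun (measurable_eventTime p) (measurable_eventTime q)) (Sum.inl p) ?_
    refine Eventually.of_forall fun ω => ?_
    refine expMeasure_absolutelyContinuous (measure_mono_null (t :=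
      {eventTime ω q - ∑ i ∈ Finset.range p.2, ω (Sum.inl (p.1, i))}) ?_ (measure_singleton _))
    intro u hu
    change eventTime _ p = eventTime _ q at hu
    rw [eventTime_update_inl ω (Or.inl hpq.symm), eventTime, Finset.sum_range_succ] at hu
    have h1 : ∑ i ∈ Finset.range p.2, Function.update ω (Sum.inl p) u (Sum.inl (p.1, i))
        = ∑ i ∈ Finset.range p.2, ω (Sum.inl (p.1, i)) := by
      refine Finset.sum_congr rfl fun i hi => Function.update_of_ne ?_ _ _
      rw [Finset.mem_range] at hi
      intro he
      have hip : i = p.2 := congrArg Prod.snd (Sum.inl_injective he)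
      omega
    have h2 : Function.update ω (Sum.inl p) u (Sum.inl (p.1, p.2)) = u := by
      simp
    rw [h1, h2] at hu
    rw [mem_singleton_iff]
    linarith
  have hall : ∀ᵐ ω ∂clockMeasure, ∀ p q : ℕ+ × ℕ, p.1 ≠ q.1 → eventTime ω p ≠ eventTime ω q :=
    ae_all_iff.2 fun p => ae_all_iff.2 fun q => by
      by_cases h : p.1 ≠ q.1
      · filter_upwards [key p q h] with ω hω _ using hω
      · exact Eventually.of_forall fun ω h' => absurd h' h
  filter_upwards [hall, ae_clock_pos] with ω hω hpos
  rintro ⟨x, i⟩ ⟨y, j⟩ hpq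
  by_cases h : x = y
  · subst h
    rw [(eventTime_strictMono hpos x).injective hpq]
  · exact absurd hpq (hω _ _ h)

lemma clockMeasure_eventTime_le (p : ℕ+ × ℕ) (s : ℝ) :
    clockMeasure {ω | eventTime ω p ≤ s} ≤ expMeasure 1 (Iic s) ^ (p.2 + 1) := by
  have hk : Function.Injective fun j : ℕ => (Sum.inl (p.1, j) : (ℕ+ × ℕ) ⊕ (ℕ+ × ℕ)) :=
    fun i j h => by simpa using h
  rw [← clockMeasure_forall_mem_le hk measurableSet_Iic]
  refine measure_mono_ae ?_
  filter_upwards [ae_clock_pos] with ω hω h j hj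
  exact (clock_le_eventTime hω (Nat.lt_succ_iff.1 hj)).trans h

open Classical in
-- The holding time is independent of the event time, and an event by time s forces all gaps before
-- it to be at most s. The mean is thus dominated by ∑ γ(x) times a convergent geometric series.
lemma lintegral_gam_lt_top {γ : ℕ+ → ℝ} (hγ : ∀ x, 0 < γ x) (hsum : Summable γ) (s : ℝ) :
    ∫⁻ ω, Gam γ ω s ∂clockMeasure < ∞ := by
  set m := ∫⁻ u, ENNReal.ofReal u ∂expMeasure 1
  have hterm : ∀ p : ℕ+ × ℕ, ∫⁻ ω, (if eventTime ω p ≤ s then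
      ENNReal.ofReal (γ p.1 * ω (Sum.inr p)) else 0) ∂clockMeasure
      ≤ ENNReal.ofReal (γ p.1) * (m * expMeasure 1 (Iic s) ^ (p.2 + 1)) := by
    intro p
    rw [lintegral_clockMeasure_update
      (.ite (measurableSet_le (measurable_eventTime p) measurable_const)
        (by fun_prop) (by fun_prop)) (Sum.inr p)]
    have h1 : ∀ ω : Clocks, ∫⁻ u, (if eventTime (Function.update ω (Sum.inr p) u) p ≤ s then
        ENNReal.ofReal (γ p.1 * Function.update ω (Sum.inr p) u (Sum.inr p)) else 0)
          ∂expMeasure 1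
        = ({ω | eventTime ω p ≤ s} : Set Clocks).indicator
            (fun _ => ENNReal.ofReal (γ p.1) * m) ω := by
      intro ω
      simp only [eventTime_update_inr, Function.update_self, indicator_apply]
      by_cases h : eventTime ω p ≤ s
      · simp only [h, if_true, ENNReal.ofReal_mul (hγ p.1).le]
        rw [lintegral_const_mul _ (by fun_prop), if_pos (by exact h)]
      · simp only [h, if_false, lintegral_zero]
        rw [if_neg (by exact h)]
    simp only [h1]
    rw [lintegral_indicator_const (measurableSet_le (measurable_eventTime p) measurable_const),
      mul_assoc]
    gcongr
    exact clockMeasure_eventTime_le p s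
  unfold Gam
  rw [lintegral_tsum fun p =>
    (Measurable.ite (measurableSet_le (measurable_eventTime p) measurable_const)
        (by fun_prop) (by fun_prop)).aemeasurable]
  refine (ENNReal.tsum_le_tsum hterm).trans_lt ?_
  rw [ENNReal.tsum_prod']
  simp only [ENNReal.tsum_mul_left, ENNReal.tsum_mul_right, pow_succ, ENNReal.tsum_geometric]
  have hc := expMeasure_Iic_lt_one s
  refine ENNReal.mul_lt_top hsum.tsum_ofReal_lt_top
    (ENNReal.mul_lt_top lintegral_expMeasure_lt_top (ENNReal.mul_lt_top ?_ (measure_lt_top _ _)))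
  exact ENNReal.inv_lt_top.2 (tsub_pos_of_lt hc)

lemma ae_isGood {γ : ℕ+ → ℝ} (hγ : ∀ x, 0 < γ x) (hsum : Summable γ) :
    ∀ᵐ ω ∂clockMeasure, IsGood γ ω := by
  have hfin : ∀ᵐ ω ∂clockMeasure, ∀ n : ℕ, Gam γ ω n < ∞ := ae_all_iff.2 fun n =>
    ae_lt_top (measurable_gam γ measurable_const) (lintegral_gam_lt_top hγ hsum n).ne
  -- The first events of the different states, which are i.i.d., are already dense; rational
  -- endpoints keep the exceptional set null.
  have hdense : ∀ᵐ ω ∂clockMeasure, ∀ a b : ℚ, (0 ≤ a ∧ a < b) →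
      ∃ j : ℕ, ω (Sum.inl (j.succPNat, 0)) ∉ (Ioo (a : ℝ) b)ᶜ := by
    refine ae_all_iff.2 fun a => ae_all_iff.2 fun b => ?_
    by_cases h : 0 ≤ a ∧ a < b
    · have hk : Function.Injective
          fun j : ℕ => (Sum.inl (j.succPNat, 0) : (ℕ+ × ℕ) ⊕ (ℕ+ × ℕ)) :=
        fun i j h => by simpa using h
      filter_upwards [ae_exists_clock_notMem hk measurableSet_Ioo.compl
        (expMeasure_compl_Ioo_lt_one (a := a) (b := b) (by exact_mod_cast h.1)
          (by exact_mod_cast h.2))] with ω hω _ using hω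
    · exact Eventually.of_forall fun ω h' => absurd h' h
  have hlarge : ∀ᵐ ω ∂clockMeasure, ∀ (x : ℕ+) (n : ℕ),
      ∃ j : ℕ, ω (Sum.inl (x, j)) ∉ Iic (n : ℝ) :=
    ae_all_iff.2 fun x => ae_all_iff.2 fun n =>
      ae_exists_clock_notMem (k := fun j => Sum.inl (x, j)) (fun i j h => by simpa using h)
        measurableSet_Iic (expMeasure_Iic_lt_one _)
  have hlarge' : ∀ᵐ ω ∂clockMeasure, ∀ n : ℕ,
      ∃ j : ℕ, ω (Sum.inr (1, j)) ∉ Iic (n : ℝ) :=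
    ae_all_iff.2 fun n =>
      ae_exists_clock_notMem (k := fun j => Sum.inr (1, j)) (fun i j h => by simpa using h)
        measurableSet_Iic (expMeasure_Iic_lt_one _)
  filter_upwards [ae_clock_pos, ae_injective_eventTime, hfin, hdense, hlarge, hlarge'] with
    ω hpos hinj hfin hdense hlarge hlarge'
  refine ⟨⟨fun p => (hpos _).le, hinj, fun s => ?_, fun t => ?_⟩, hpos, fun x s => ?_,
    fun a b ha hab => ?_⟩
  · obtain ⟨n, hn⟩ := exists_nat_ge s
    exact (gam_mono γ ω hn).trans_lt (hfin n)
  · obtain ⟨n, hn⟩ := exists_nat_ge ((t : ℝ) / γ 1)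
    obtain ⟨j, hj⟩ := hlarge' n
    refine ⟨eventTime ω (1, j), ?_⟩
    rw [gam_eventTime hinj]
    refine lt_of_lt_of_le ?_ le_add_self
    rw [mem_Iic, not_le] at hj
    have : (t : ℝ) < γ 1 * ω (Sum.inr (1, j)) := by
      have h2 := lt_of_le_of_lt hn hj
      rwa [div_lt_iff₀ (hγ 1), mul_comm] at h2
    rw [ENNReal.lt_ofReal_iff_toReal_lt ENNReal.coe_ne_top]
    simpa using this
  -- One gap longer than n pushes all later events of x beyond s.
  · obtain ⟨n, hn⟩ := exists_nat_ge s
    obtain ⟨j, hj⟩ := hlarge x n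
    refine (finite_lt_nat j).subset fun i hi => ?_
    by_contra hc
    rw [mem_Iic, not_le] at hj
    have h1 := (clock_le_eventTime (p := (x, j)) hpos le_rfl).trans
      ((eventTime_strictMono hpos x).monotone (not_lt.1 hc))
    have h2 : eventTime ω (x, i) ≤ s := hi
    simp only at h1
    linarith
  · obtain ⟨a', ha1, ha2⟩ := exists_rat_btwn hab
    obtain ⟨b', hb1, hb2⟩ := exists_rat_btwn ha2
    obtain ⟨j, hj⟩ := hdense a' b' ⟨by exact_mod_cast ha.trans ha1.le, by exact_mod_cast hb1⟩
    rw [notMem_compl_iff] at hj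
    refine ⟨(j.succPNat, 0), ?_⟩
    have : eventTime ω (j.succPNat, 0) = ω (Sum.inl (j.succPNat, 0)) := by simp [eventTime]
    rw [this]
    exact ⟨ha1.trans hj.1, hj.2.trans hb2⟩

lemma IsGood.kPath_apply {γ : ℕ+ → ℝ} {ω : Clocks} (h : IsGood γ ω) (t : ℝ≥0) :
    (kPath γ ω).1 t = kState γ ω t := by
  rw [kPath, dif_pos h.isCadlag]

/-- `kState` is defined by a choice, so measurability is checked on a measurable set of good
realizations, where being at x is a countable union of `Covers` events. -/
lemma aemeasurable_kPath {γ : ℕ+ → ℝ} (hγ : ∀ x, 0 < γ x) (hsum : Summable γ) :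
    AEMeasurable (kPath γ) clockMeasure := by
  classical
  obtain ⟨A, hA0, hAm, hA⟩ := (ae_isGood hγ hsum).exists_measurable_mem
  refine ⟨A.piecewise (kPath γ) fun _ => ⟨fun _ => OnePoint.infty, isCadlag_const _⟩, ?_, ?_⟩
  · refine Measurable.subtype_mk (f := fun ω => (A.piecewise (kPath γ)
      (fun _ => ⟨fun _ => OnePoint.infty, isCadlag_const _⟩) ω).1) ?_
    refine measurable_pi_iff.2 fun t => ?_
    have he : (fun ω => (A.piecewise (kPath γ)
        (fun _ => ⟨fun _ => OnePoint.infty, isCadlag_const _⟩) ω).1 t)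
        = fun ω => if ω ∈ A then kState γ ω t else OnePoint.infty := by
      ext ω
      by_cases h : ω ∈ A
      · simp only [piecewise_eq_of_mem _ _ _ h, h, if_true]
        exact (hA ω h).kPath_apply t
      · simp only [piecewise_eq_of_notMem _ _ _ h, h, if_false]
    have hcoe : ∀ x : ℕ+, MeasurableSet
        ((fun ω => if ω ∈ A then kState γ ω t else OnePoint.infty) ⁻¹' {(x : State)}) := by
      intro x
      have : ((fun ω => if ω ∈ A then kState γ ω t else OnePoint.infty) ⁻¹' {(x : State)})
          = A ∩ ⋃ j, {ω | Covers γ ω (x, j) t} := by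
        ext ω
        by_cases h : ω ∈ A
        · simp [h, kState_eq_coe_iff (hA ω h).inj]
        · simp [h, OnePoint.infty_ne_coe]
      rw [this]
      exact hAm.inter (MeasurableSet.iUnion fun j => measurableSet_covers γ _ _)
    rw [he]
    have : Countable State := inferInstanceAs (Countable (Option ℕ+))
    refine measurable_to_countable' fun y => ?_
    induction y using OnePoint.rec with
    | coe x => exact hcoe x
    | infty =>
      have : ((fun ω => if ω ∈ A then kState γ ω t else OnePoint.infty) ⁻¹' {OnePoint.infty})
          = (⋃ x : ℕ+, (fun ω => if ω ∈ A then kState γ ω t else OnePoint.infty) ⁻¹'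
            {(x : State)})ᶜ := by
        ext ω
        simp only [mem_preimage, mem_singleton_iff, mem_compl_iff, mem_iUnion]
        rw [← not_iff_not, not_not, ← ne_eq, OnePoint.ne_infty_iff_exists]
        exact exists_congr fun x => eq_comm
      rw [this]
      exact (MeasurableSet.iUnion hcoe).compl
  · filter_upwards [hA0] with ω hω
    exact (piecewise_eq_of_mem _ _ _ hω).symm

/-! ### The next event of a clock is independent of the current excursion -/

/-- The gap after p affects only events that come after p both before and after the change, so Γ up
to and including the event p is the same. -/
lemma covers_update_inl [DecidableEq ((ℕ+ × ℕ) ⊕ (ℕ+ × ℕ))] (γ : ℕ+ → ℝ) {ω : Clocks}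
    (hω : ∀ k, 0 < ω k) {u : ℝ} (hu : 0 < u) (p : ℕ+ × ℕ) (t : ℝ≥0∞) :
    Covers γ (Function.update ω (Sum.inl (p.1, p.2 + 1)) u) p t ↔ Covers γ ω p t := by
  set ω' := Function.update ω (Sum.inl (p.1, p.2 + 1)) u with hω'
  have hpos' : ∀ k, 0 < ω' k := by
    intro k
    rcases eq_or_ne k (Sum.inl (p.1, p.2 + 1)) with rfl | h
    · simpa [hω'] using hu
    · simpa [hω', Function.update_of_ne h] using hω k
  have hp : eventTime ω' p = eventTime ω p :=
    eventTime_update_inl ω (Or.inr (Nat.lt_succ_self _)) u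
  have hcmp : ∀ q, (eventTime ω' q = eventTime ω q) ∨
      (eventTime ω p < eventTime ω q ∧ eventTime ω p < eventTime ω' q) := by
    rintro ⟨y, j⟩
    by_cases hy : y = p.1
    · subst hy
      rcases lt_or_ge j (p.2 + 1) with hj | hj
      · exact Or.inl (eventTime_update_inl ω (Or.inr hj) u)
      · refine Or.inr ⟨eventTime_strictMono hω p.1 hj, ?_⟩
        rw [← hp]
        exact eventTime_strictMono hpos' p.1 hj
    · exact Or.inl (eventTime_update_inl ω (Or.inl hy) u)
  have hT : ∀ q, ω' (Sum.inr q) = ω (Sum.inr q) := fun q => by simp [hω']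
  have hL : GamLeft γ ω' (eventTime ω' p) = GamLeft γ ω (eventTime ω p) := by
    rw [hp]
    refine tsum_congr fun q => ?_
    rw [hT]
    rcases hcmp q with h | ⟨h1, h2⟩
    · rw [h]
    · rw [if_neg h1.le.not_gt, if_neg h2.le.not_gt]
  have hG : Gam γ ω' (eventTime ω' p) = Gam γ ω (eventTime ω p) := by
    rw [hp]
    refine tsum_congr fun q => ?_
    rw [hT]
    rcases hcmp q with h | ⟨h1, h2⟩
    · rw [h]
    · rw [if_neg h1.not_ge, if_neg h2.not_ge]
  rw [Covers, Covers, hL, hG]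

/-- At time `t` there is an excursion whose state has its next event within local time `δ`. -/
def shortGap (γ : ℕ+ → ℝ) (δ : ℝ) (t : ℝ≥0∞) : Set Clocks :=
  ⋃ p : ℕ+ × ℕ, {ω | Covers γ ω p t ∧ ω (Sum.inl (p.1, p.2 + 1)) ≤ δ}

lemma measurableSet_covers_inter (γ : ℕ+ → ℝ) (δ : ℝ) (t : ℝ≥0∞) (p : ℕ+ × ℕ) :
    MeasurableSet {ω | Covers γ ω p t ∧ ω (Sum.inl (p.1, p.2 + 1)) ≤ δ} :=
  (measurableSet_covers γ p t).inter
    (measurableSet_le (measurable_pi_apply (Sum.inl (p.1, p.2 + 1))) measurable_const)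

lemma measurableSet_shortGap (γ : ℕ+ → ℝ) (δ : ℝ) (t : ℝ≥0∞) :
    MeasurableSet (shortGap γ δ t) :=
  MeasurableSet.iUnion fun p => measurableSet_covers_inter γ δ t p

lemma clockMeasure_covers_inter (γ : ℕ+ → ℝ) (δ : ℝ) (t : ℝ≥0∞) (p : ℕ+ × ℕ) :
    clockMeasure {ω | Covers γ ω p t ∧ ω (Sum.inl (p.1, p.2 + 1)) ≤ δ}
      = clockMeasure {ω | Covers γ ω p t} * expMeasure 1 (Iic δ) := by
  classical
  rw [← lintegral_indicator_one (measurableSet_covers_inter γ δ t p),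
    lintegral_clockMeasure_update
      (measurable_one.indicator (measurableSet_covers_inter γ δ t p))
      (Sum.inl (p.1, p.2 + 1)), mul_comm,
    ← lintegral_indicator_const (measurableSet_covers γ p t)]
  refine lintegral_congr_ae ?_
  filter_upwards [ae_clock_pos] with ω hω
  have h1 : ∀ᵐ u ∂expMeasure 1, ({ω | Covers γ ω p t ∧ ω (Sum.inl (p.1, p.2 + 1)) ≤ δ} :
        Set Clocks).indicator (1 : Clocks → ℝ≥0∞)
          (Function.update ω (Sum.inl (p.1, p.2 + 1)) u)
      = (Iic δ).indicator (fun _ => if Covers γ ω p t then 1 else 0) u := by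
    filter_upwards [expMeasure_ae_pos] with u hu
    simp only [indicator_apply, Pi.one_apply, mem_Iic]
    have : Function.update ω (Sum.inl (p.1, p.2 + 1)) u
        ∈ ({ω | Covers γ ω p t ∧ ω (Sum.inl (p.1, p.2 + 1)) ≤ δ} : Set Clocks)
        ↔ Covers γ ω p t ∧ u ≤ δ := by
      rw [← covers_update_inl γ hω hu p t]
      simp
    rw [if_congr this rfl rfl]
    by_cases h : u ≤ δ <;> by_cases h' : Covers γ ω p t <;> simp [h, h']
  rw [lintegral_congr_ae h1, lintegral_indicator_const measurableSet_Iic]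
  by_cases h : Covers γ ω p t
  · rw [if_pos h, one_mul, indicator_of_mem (by exact h)]
  · rw [if_neg h, zero_mul, indicator_of_notMem (by exact h)]

/-- Each term is a product by independence, and the almost surely disjoint events `Covers γ ω p t`
have total probability at most 1. -/
lemma clockMeasure_shortGap_le (γ : ℕ+ → ℝ) (δ : ℝ) (t : ℝ≥0∞) :
    clockMeasure (shortGap γ δ t) ≤ expMeasure 1 (Iic δ) := by
  have hdisj : Pairwise (Function.onFun (AEDisjoint clockMeasure)
      fun p => {ω | Covers γ ω p t}) := by
    intro p q hpq
    rw [Function.onFun, AEDisjoint, measure_eq_zero_iff_ae_notMem]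
    filter_upwards [ae_injective_eventTime] with ω hω hc
    exact hpq (Covers.unique hω hc.1 hc.2)
  refine (measure_iUnion_le _).trans ?_
  simp only [clockMeasure_covers_inter]
  rw [ENNReal.tsum_mul_right, ← measure_iUnion₀ hdisj
    fun p => (measurableSet_covers γ p t).nullMeasurableSet]
  exact mul_le_of_le_one_left zero_le prob_le_one

/-! ### The end of the excursion that contains a given time -/

section Exit

variable {γ : ℕ+ → ℝ} {ω : Clocks}

lemma IsGood.gamLeft_lt_gam (h : IsGood γ ω) (hγ : ∀ x, 0 < γ x) (p : ℕ+ × ℕ) :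
    GamLeft γ ω (eventTime ω p) < Gam γ ω (eventTime ω p) := by
  rw [gam_eventTime h.inj]
  exact ENNReal.lt_add_right ((gamLeft_le_gam γ ω _).trans_lt (h.fin _)).ne
    (ENNReal.ofReal_pos.2 (mul_pos (hγ _) (h.pos _))).ne'

lemma IsGood.gam_lt_gamLeft (h : IsGood γ ω) (hγ : ∀ x, 0 < γ x) {a b : ℝ} (ha : 0 ≤ a)
    (hab : a < b) : Gam γ ω a < GamLeft γ ω b := by
  obtain ⟨p, h1, h2⟩ := h.dense a b ha hab
  exact (gam_le_gamLeft γ ω h1).trans_lt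
    ((h.gamLeft_lt_gam hγ p).trans_le (gam_le_gamLeft γ ω h2))

/-- Γ is strictly increasing by density of the events, so no excursion starts exactly where another
ends: the process leaves a finite state to ∞. -/
lemma IsGood.not_covers_gam (h : IsGood γ ω) (hγ : ∀ x, 0 < γ x) (p q : ℕ+ × ℕ) :
    ¬ Covers γ ω q (Gam γ ω (eventTime ω p)) := by
  intro hq
  have hlt : eventTime ω p < eventTime ω q := by
    by_contra hc
    exact absurd (hq.2.trans_le (gam_mono γ ω (not_lt.1 hc))) (lt_irrefl _)
  exact absurd (hq.1.trans_lt (h.gam_lt_gamLeft hγ (eventTime_pos h.pos p).le hlt)) (lt_irrefl _)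

open Classical in
/-- The end of the excursion that contains the time `t`. -/
def exitTime (γ : ℕ+ → ℝ) (ω : Clocks) (t : ℝ≥0∞) : ℝ≥0∞ :=
  ∑' p, if Covers γ ω p t then Gam γ ω (eventTime ω p) else 0

lemma measurable_exitTime (γ : ℕ+ → ℝ) (t : ℝ≥0∞) : Measurable fun ω => exitTime γ ω t :=
  Measurable.tsum fun p => Measurable.ite (measurableSet_covers γ p t)
    (measurable_gam γ (measurable_eventTime p)) measurable_const

/-- Only one excursion contains t, so the sum has one term; writing `exitTime` as a sum makes its
measurability immediate. -/
lemma Covers.exitTime_eq (hinj : Function.Injective (eventTime ω)) {p : ℕ+ × ℕ} {t : ℝ≥0∞}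
    (hp : Covers γ ω p t) : exitTime γ ω t = Gam γ ω (eventTime ω p) := by
  rw [exitTime, tsum_eq_single p fun q hq => if_neg fun hc => hq (hc.unique hinj hp), if_pos hp]

/-- The realizations of the clocks for which the times `t` and `t + θ t` belong to excursions. -/
structure IsGoodAt (γ : ℕ+ → ℝ) (ω : Clocks) (t θ : ℝ≥0) : Prop extends IsGood γ ω where
  atStart : ∃ p, Covers γ ω p t
  atEnd : ∃ p, Covers γ ω p (t + θ * t : ℝ≥0)

lemma ae_isGoodAt {γ : ℕ+ → ℝ} (hγ : ∀ x, 0 < γ x) (hsum : Summable γ) {t : ℝ≥0} (ht : 0 < t)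
    (θ : ℝ≥0) : ∀ᵐ ω ∂clockMeasure, IsGoodAt γ ω t θ := by
  have hreg : ∀ᵐ ω ∂clockMeasure, IsRegular γ ω :=
    (ae_isGood hγ hsum).mono fun ω h => h.toIsRegular
  filter_upwards [ae_isGood hγ hsum, ae_exists_covers hγ hreg ht,
    ae_exists_covers hγ hreg (t := t + θ * t) (by positivity)] with ω h1 h2 h3
  exact ⟨h1, h2, h3⟩

/-- The excursion of the process that contains the time `t`: its state `x`, and its end `b`. -/
lemma IsGoodAt.exists_excursion {t θ : ℝ≥0} (h : IsGoodAt γ ω t θ) (hγ : ∀ x, 0 < γ x) :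
    ∃ (p : ℕ+ × ℕ) (b : ℝ≥0), Covers γ ω p t ∧ exitTime γ ω t = b ∧
      Gam γ ω (eventTime ω p) = b ∧ t < b ∧ b ≠ t + θ * t ∧
      (∀ u : ℝ≥0, t ≤ u → u < b → (kPath γ ω).1 u = (p.1 : State)) ∧
      (kPath γ ω).1 b = OnePoint.infty := by
  obtain ⟨p, hp⟩ := h.atStart
  have hb : Gam γ ω (eventTime ω p) = (Gam γ ω (eventTime ω p)).toNNReal :=
    (ENNReal.coe_toNNReal (h.fin _).ne).symm
  refine ⟨p, (Gam γ ω (eventTime ω p)).toNNReal, hp, ?_, hb, ?_, ?_, ?_, ?_⟩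
  · rw [hp.exitTime_eq h.inj, ← hb]
  · have := hp.2
    rw [hb] at this
    exact_mod_cast this
  -- Ends of excursions are uncovered, whereas t + θ t is covered; this excludes the boundary case a
  -- = θ.
  · intro hc
    obtain ⟨q, hq⟩ := h.atEnd
    rw [← hc, ← hb] at hq
    exact h.not_covers_gam hγ p q hq
  · intro u h1 h2
    rw [h.kPath_apply]
    refine Covers.kState_eq h.inj ⟨hp.1.trans (by exact_mod_cast h1), ?_⟩
    rw [hb]
    exact_mod_cast h2
  · rw [h.kPath_apply, kState_eq_infty_iff]
    intro q
    rw [← hb]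
    exact h.not_covers_gam hγ p q

open Classical in
lemma IsGoodAt.noJump_eq {t θ : ℝ≥0} (h : IsGoodAt γ ω t θ) (hγ : ∀ x, 0 < γ x) (r : ℝ≥0) :
    noJump t r (kPath γ ω) = if ((t + r : ℝ≥0) : ℝ≥0∞) < exitTime γ ω t then 1 else 0 := by
  obtain ⟨p, b, -, hexit, -, htb, -, hx, hinf⟩ := h.exists_excursion hγ
  rw [noJump, hexit]
  refine if_congr ?_ rfl rfl
  rw [ENNReal.coe_lt_coe, hx t le_rfl htb]
  constructor
  · intro hs
    by_contra hc
    have := hs b ⟨htb.le, not_lt.1 hc⟩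
    rw [hinf] at this
    exact OnePoint.infty_ne_coe _ this
  · rintro hs u ⟨h1, h2⟩
    exact hx u h1 (h2.trans_lt hs)

end Exit

/-! ### Two-time functionals of a path with one jump -/

namespace IsTwoTimeFunctional

variable {Φ : ℝ≥0 → ℝ≥0 → CPath → ℝ} {Ψ₁ : ℝ → ℝ}
  {Ξ : (θ : ℝ≥0) → ℕ+ → (s : ℝ≥0) → Seg (θ - s) → ℝ} {Ψ₂ : ℝ → ℝ → ℝ}

lemma eq_of_constant (hΦ : IsTwoTimeFunctional Φ Ψ₁ Ξ Ψ₂) {t θ : ℝ≥0} (ht : 0 < t) (hθ : 0 < θ)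
    {ζ : CPath} {x : ℕ+} (hx : ∀ u, t ≤ u → u ≤ t + θ * t → ζ.1 u = (x : State)) :
    Φ t (θ * t) ζ = Ψ₁ θ := by
  rw [hΦ.scaling t (θ * t) ht (by positivity), mul_div_cancel_right₀ _ ht.ne']
  refine hΦ.constant θ hθ x _ fun u hu => hx _ (le_mul_of_one_le_right zero_le hu.1) ?_
  calc t * u ≤ t * (1 + θ) := mul_le_mul_right hu.2 t
    _ = t + θ * t := by ring

lemma eq_of_firstJump (hΦ : IsTwoTimeFunctional Φ Ψ₁ Ξ Ψ₂) {t θ s : ℝ≥0} (ht : 0 < t)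
    (hs : 0 < s) (hsθ : s < θ) {ζ : CPath} {x : ℕ+}
    (hx : ∀ u, t ≤ u → u < t * (1 + s) → ζ.1 u = (x : State))
    (hne : ζ.1 (t * (1 + s)) ≠ (x : State)) :
    Φ t (θ * t) ζ = Ξ θ x s (piece (rescale t ζ) (1 + s) (θ - s)) := by
  have hθ := hs.trans hsθ
  rw [hΦ.scaling t (θ * t) ht (by positivity), mul_div_cancel_right₀ _ ht.ne']
  exact hΦ.firstJump θ s hs hsθ x _ (fun u hu => hx _ (le_mul_of_one_le_right zero_le hu.1)
    (mul_lt_mul_of_pos_left hu.2 ht)) hne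

lemma integral_deriv (hΦ : IsTwoTimeFunctional Φ Ψ₁ Ξ Ψ₂) {θ : ℝ} (hθ : 0 < θ) :
    ∫ s in (0 : ℝ)..θ, deriv (fun r => Ψ₂ r θ) s = Ψ₂ θ θ - Ψ₂ 0 θ :=
  intervalIntegral.integral_eq_sub_of_hasDerivAt_of_tendsto hθ
    (fun s hs => (hΦ.psi_diff θ hθ s hs).hasDerivAt) (hΦ.psi_int θ hθ) (hΦ.psi_zero θ hθ)
    (hΦ.psi_self θ hθ)

lemma integral_deriv_of_lt (hΦ : IsTwoTimeFunctional Φ Ψ₁ Ξ Ψ₂) {θ a : ℝ} (ha : 0 < a)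
    (haθ : a < θ) : ∫ s in (0 : ℝ)..a, deriv (fun r => Ψ₂ r θ) s = Ψ₂ a θ - Ψ₂ 0 θ := by
  have hθ := ha.trans haθ
  refine intervalIntegral.integral_eq_sub_of_hasDerivAt_of_tendsto ha
    (fun s hs => (hΦ.psi_diff θ hθ s ⟨hs.1, hs.2.trans haθ⟩).hasDerivAt)
    ((hΦ.psi_int θ hθ).mono_set ?_) (hΦ.psi_zero θ hθ) ?_
  · rw [uIcc_of_le ha.le, uIcc_of_le hθ.le]
    exact Icc_subset_Icc_right haθ.le
  · exact (hΦ.psi_diff θ hθ a ⟨ha, haθ⟩).continuousAt.tendsto.mono_left nhdsWithin_le_nhds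

end IsTwoTimeFunctional

open Classical in
/-- The indicator of the event that the excursion containing `t` lasts beyond `t + s t`. -/
def survival (γ : ℕ+ → ℝ) (t : ℝ≥0) (s : ℝ) (ω : Clocks) : ℝ :=
  if ENNReal.ofReal (t + s * t) < exitTime γ ω t then 1 else 0

/-- The value that `Φ(t, θ t; Y)` takes if the process is identically `∞` after it leaves the state
occupied at time `t`. -/
def surrogate (Ψ₁ : ℝ → ℝ) (Ψ₂ : ℝ → ℝ → ℝ) (γ : ℕ+ → ℝ) (t : ℝ≥0) (θ : ℝ) (ω : Clocks) : ℝ :=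
  Ψ₂ 0 θ + (Ψ₁ θ - Ψ₂ θ θ) * survival γ t θ ω
    + ∫ s in (0 : ℝ)..θ, deriv (fun r => Ψ₂ r θ) s * survival γ t s ω

open Classical in
lemma survival_eq {γ : ℕ+ → ℝ} {t a : ℝ≥0} {ω : Clocks} (ht : 0 < t)
    (hb : exitTime γ ω t = (t * (1 + a) : ℝ≥0)) (s : ℝ) :
    survival γ t s ω = if s < a then 1 else 0 := by
  refine if_congr ?_ rfl rfl
  rw [hb, ← ENNReal.ofReal_coe_nnreal, ENNReal.ofReal_lt_ofReal_iff (by positivity)]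
  have ht' : (0 : ℝ) < t := ht
  push_cast
  constructor
  · intro h
    have : (t : ℝ) * s < t * a := by linarith
    exact lt_of_mul_lt_mul_left this ht'.le
  · intro h
    have := mul_lt_mul_of_pos_left h ht'
    linarith

lemma abs_survival_le (γ : ℕ+ → ℝ) (t : ℝ≥0) (s : ℝ) (ω : Clocks) : |survival γ t s ω| ≤ 1 := by
  rw [survival]
  split_ifs <;> simp

lemma measurable_survival (γ : ℕ+ → ℝ) (t : ℝ≥0) :
    Measurable fun q : ℝ × Clocks => survival γ t q.1 q.2 :=
  Measurable.ite (measurableSet_lt (by fun_prop) ((measurable_exitTime γ t).comp measurable_snd))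
    measurable_const measurable_const

/-! ### The functional and its surrogate on a single realization -/

section

variable {Φ : ℝ≥0 → ℝ≥0 → CPath → ℝ} {Ψ₁ : ℝ → ℝ}
  {Ξ : (θ : ℝ≥0) → ℕ+ → (s : ℝ≥0) → Seg (θ - s) → ℝ} {Ψ₂ : ℝ → ℝ → ℝ}
  {γ : ℕ+ → ℝ} {ω : Clocks} {t θ : ℝ≥0}

/-- All survival indicators equal 1, and the integral Ψ₂(θ, θ) - Ψ₂(0, θ) cancels every Ψ₂ term. -/
lemma surrogate_of_lt (hΦ : IsTwoTimeFunctional Φ Ψ₁ Ξ Ψ₂) (ht : 0 < t) (hθ : 0 < θ) {a : ℝ≥0}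
    (hb : exitTime γ ω t = (t * (1 + a) : ℝ≥0)) (ha : θ < a) :
    surrogate Ψ₁ Ψ₂ γ t θ ω = Ψ₁ θ := by
  have ha' : (θ : ℝ) < a := ha
  have h1 : ∫ s in (0 : ℝ)..θ, deriv (fun r => Ψ₂ r θ) s * survival γ t s ω
      = ∫ s in (0 : ℝ)..θ, deriv (fun r => Ψ₂ r θ) s := by
    refine intervalIntegral.integral_congr fun s hs => ?_
    rw [uIcc_of_le (NNReal.coe_nonneg θ)] at hs
    rw [survival_eq ht hb, if_pos (hs.2.trans_lt ha'), mul_one]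
  rw [surrogate, h1, hΦ.integral_deriv (by exact_mod_cast hθ), survival_eq ht hb, if_pos ha']
  ring

lemma surrogate_of_gt (hΦ : IsTwoTimeFunctional Φ Ψ₁ Ξ Ψ₂) (ht : 0 < t) {a : ℝ≥0}
    (hb : exitTime γ ω t = (t * (1 + a) : ℝ≥0)) (ha0 : 0 < a) (ha : a < θ) :
    surrogate Ψ₁ Ψ₂ γ t θ ω = Ψ₂ a θ := by
  have ha' : (a : ℝ) < θ := ha
  have ha0' : (0 : ℝ) < a := ha0
  have hθ' := ha0'.trans ha'
  have hint := hΦ.psi_int θ hθ'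
  have hz : EqOn (fun s => deriv (fun r => Ψ₂ r θ) s * survival γ t s ω) (fun _ => 0)
      (uIoc (a : ℝ) θ) := by
    intro s hs
    rw [uIoc_of_le ha'.le] at hs
    simp only
    rw [survival_eq ht hb, if_neg hs.1.not_gt, mul_zero]
  -- Survival means s < a strictly, so the single point s = a has to be discarded.
  have hg : ∀ᵐ s : ℝ, s ∈ uIoc (0 : ℝ) a → deriv (fun r => Ψ₂ r θ) s * survival γ t s ω
      = deriv (fun r => Ψ₂ r θ) s := by
    have hne : ∀ᵐ s : ℝ, s ≠ a := by simp [ae_iff]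
    filter_upwards [hne] with s hs1 hs
    rw [uIoc_of_le ha0'.le] at hs
    rw [survival_eq ht hb, if_pos (lt_of_le_of_ne hs.2 hs1), mul_one]
  have hint1 : IntervalIntegrable (deriv fun r => Ψ₂ r θ) volume 0 a := by
    refine hint.mono_set ?_
    rw [uIcc_of_le ha0'.le, uIcc_of_le hθ'.le]
    exact Icc_subset_Icc_right ha'.le
  have h1 : ∫ s in (0 : ℝ)..θ, deriv (fun r => Ψ₂ r θ) s * survival γ t s ω
      = ∫ s in (0 : ℝ)..a, deriv (fun r => Ψ₂ r θ) s := by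
    rw [← intervalIntegral.integral_add_adjacent_intervals (b := (a : ℝ)),
      intervalIntegral.integral_congr_ae hg,
      intervalIntegral.integral_zero_ae (a := (a : ℝ)) (Eventually.of_forall hz), add_zero]
    · refine hint1.congr_ae ?_
      rw [Filter.EventuallyEq, ae_restrict_iff' measurableSet_uIoc]
      filter_upwards [hg] with s hs h using (hs h).symm
    · exact IntervalIntegrable.congr hz.symm intervalIntegrable_const
  rw [surrogate, h1, hΦ.integral_deriv_of_lt ha0' ha', survival_eq ht hb, if_neg ha'.le.not_gt]
  ring

/-- The approximation of `Φ(t, θ t; Y)` by its surrogate, with the uniform bound. -/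
lemma IsGoodAt.cases (hΦ : IsTwoTimeFunctional Φ Ψ₁ Ξ Ψ₂) (hγ : ∀ x, 0 < γ x) (ht : 0 < t)
    (hθ : 0 < θ) (h : IsGoodAt γ ω t θ) :
    (Φ t (θ * t) (kPath γ ω) = Ψ₁ θ ∧ surrogate Ψ₁ Ψ₂ γ t θ ω = Ψ₁ θ) ∨
    ∃ (p : ℕ+ × ℕ) (s : ℝ≥0), 0 < s ∧ s < θ ∧ Covers γ ω p t ∧
      Gam γ ω (eventTime ω p) = (t * (1 + s) : ℝ≥0) ∧
      Φ t (θ * t) (kPath γ ω) = Ξ θ p.1 s (piece (rescale t (kPath γ ω)) (1 + s) (θ - s)) ∧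
      surrogate Ψ₁ Ψ₂ γ t θ ω = Ψ₂ s θ := by
  obtain ⟨p, b, hp, hexit, hG, htb, hbne, hx, hinf⟩ := h.exists_excursion hγ
  obtain ⟨s, hs0, rfl⟩ : ∃ s : ℝ≥0, 0 < s ∧ b = t * (1 + s) := by
    have h1 : 1 < b / t := (one_lt_div ht).2 htb
    refine ⟨b / t - 1, tsub_pos_of_lt h1, ?_⟩
    rw [add_tsub_cancel_of_le h1.le, mul_div_cancel₀ _ ht.ne']
  have hcmp : t + θ * t = t * (1 + θ) := by ring
  rcases lt_trichotomy s θ with hs | rfl | hs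
  · refine Or.inr ⟨p, s, hs0, hs, hp, hG, ?_, surrogate_of_gt hΦ ht hexit hs0 hs⟩
    exact hΦ.eq_of_firstJump ht hs0 hs hx (by rw [hinf]; exact OnePoint.infty_ne_coe _)
  · exact absurd hcmp.symm hbne
  · refine Or.inl ⟨hΦ.eq_of_constant ht hθ (x := p.1) fun u h1 h2 => hx u h1 ?_,
      surrogate_of_lt hΦ ht hθ hexit hs⟩
    rw [hcmp] at h2
    exact h2.trans_lt (mul_lt_mul_of_pos_left (by gcongr) ht)

/-- The event that a state `x ≤ M` is visited before time `r`, or that the local time at `r`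
exceeds `δ`. -/
def earlyVisit (γ : ℕ+ → ℝ) (M : ℕ+) (δ : ℝ) (r : ℝ≥0) : Set Clocks :=
  {ω | Gam γ ω δ ≤ r} ∪ ⋃ x ∈ Finset.Icc 1 M, {ω | GamLeft γ ω (eventTime ω (x, 0)) ≤ r}

lemma measurableSet_earlyVisit (γ : ℕ+ → ℝ) (M : ℕ+) (δ : ℝ) (r : ℝ≥0) :
    MeasurableSet (earlyVisit γ M δ r) :=
  (measurableSet_le (measurable_gam γ measurable_const) measurable_const).union
    (Finset.measurableSet_biUnion _ fun _ _ =>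
      measurableSet_le (measurable_gamLeft γ (measurable_eventTime _)) measurable_const)

/-- Continuity from above: almost surely Γ(δ) > 0, and the first visits to the finitely many states
up to M start at positive times. -/
lemma tendsto_earlyVisit (hγ : ∀ x, 0 < γ x) (hsum : Summable γ) (M : ℕ+) {δ : ℝ} (hδ : 0 < δ) :
    Tendsto (fun r => clockMeasure (earlyVisit γ M δ r)) (𝓝[>] 0) (𝓝 0) := by
  have h0 : clockMeasure (⋂ r > (0 : ℝ≥0), earlyVisit γ M δ r) = 0 := by
    rw [measure_eq_zero_iff_ae_notMem]
    filter_upwards [ae_isGood hγ hsum] with ω hω hmem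
    have hc : Tendsto (fun r : ℝ≥0 => (r : ℝ≥0∞)) (𝓝[>] 0) (𝓝 0) :=
      (ENNReal.continuous_coe.tendsto 0).mono_left nhdsWithin_le_nhds
    have h1 : 0 < Gam γ ω δ := by
      obtain ⟨p, -, h2⟩ := hω.dense 0 δ le_rfl hδ
      exact (zero_le.trans_lt (hω.gamLeft_lt_gam hγ p)).trans_le (gam_mono γ ω h2.le)
    have h2 : ∀ x, 0 < GamLeft γ ω (eventTime ω (x, 0)) := fun x =>
      zero_le.trans_lt (hω.gam_lt_gamLeft hγ le_rfl (eventTime_pos hω.pos (x, 0)))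
    have hev : ∀ᶠ r : ℝ≥0 in 𝓝[>] 0, (r : ℝ≥0∞) < Gam γ ω δ ∧
        ∀ x ∈ Finset.Icc 1 M, (r : ℝ≥0∞) < GamLeft γ ω (eventTime ω (x, 0)) :=
      (hc.eventually (gt_mem_nhds h1)).and ((Finset.eventually_all _).2 fun x _ =>
        hc.eventually (gt_mem_nhds (h2 x)))
    obtain ⟨r, ⟨hr1, hr2⟩, hr0⟩ := (hev.and self_mem_nhdsWithin).exists
    rcases mem_iInter₂.1 hmem r hr0 with h | h
    · exact absurd hr1 (not_lt.2 h)
    · obtain ⟨x, hx, h⟩ := mem_iUnion₂.1 h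
      exact absurd (hr2 x hx) (not_lt.2 h)
  rw [← h0]
  refine tendsto_measure_biInter_gt
    (fun r _ => (measurableSet_earlyVisit γ M δ r).nullMeasurableSet) (fun i j _ hij => ?_)
    ⟨1, one_pos, measure_ne_top _ _⟩
  have hij' : (i : ℝ≥0∞) ≤ j := by exact_mod_cast hij
  exact union_subset_union (fun ω hω => le_trans hω hij')
    (iUnion₂_mono fun x _ ω hω => le_trans hω hij')

lemma IsGoodAt.abs_sub_surrogate_le (hΦ : IsTwoTimeFunctional Φ Ψ₁ Ξ Ψ₂) (hγ : ∀ x, 0 < γ x)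
    (ht : 0 < t) (hθ : 0 < θ) (h : IsGoodAt γ ω t θ) {C : ℝ} (hC0 : 0 ≤ C)
    (hC : ∀ (x : ℕ+) (s : ℝ≥0) (η : Seg (θ - s)), 0 < s → s < θ → |Ξ θ x s η| ≤ C) :
    |Φ t (θ * t) (kPath γ ω) - surrogate Ψ₁ Ψ₂ γ t θ ω| ≤ 2 * C := by
  rcases h.cases hΦ hγ ht hθ with ⟨h1, h2⟩ | ⟨p, s, hs0, hs, -, -, h1, h2⟩
  · rw [h1, h2, sub_self, abs_zero]; positivity
  · rw [h1, h2, hΦ.psi_eq θ s hs0 hs 1]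
    refine (abs_sub _ _).trans ?_
    linarith [hC p.1 s (piece (rescale t (kPath γ ω)) (1 + s) (θ - s)) hs0 hs,
      hC 1 s (inftySeg (θ - s)) hs0 hs]

lemma IsGoodAt.abs_sub_surrogate_lt (hΦ : IsTwoTimeFunctional Φ Ψ₁ Ξ Ψ₂) (hγ : ∀ x, 0 < γ x)
    (ht : 0 < t) (hθ : 0 < θ) (h : IsGoodAt γ ω t θ) {ε δ δ' : ℝ} (hε : 0 < ε) {M : ℕ+}
    (hM : ∀ y : ℕ+, M < y → ((y : ℕ) : ℝ)⁻¹ < δ) (hδ : 0 < δ)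
    (hcont : ∀ (s : ℝ≥0) (η : Seg (θ - s)), 0 < s → s < θ →
      (∀ u, d (η.1 u) ((inftySeg (θ - s)).1 u) < δ) →
        |Ξ θ 1 s η - Ξ θ 1 s (inftySeg (θ - s))| < ε)
    (hearly : ω ∉ earlyVisit γ M δ' (t + θ * t)) (hgap : ω ∉ shortGap γ δ' t) :
    |Φ t (θ * t) (kPath γ ω) - surrogate Ψ₁ Ψ₂ γ t θ ω| < ε := by
  rcases h.cases hΦ hγ ht hθ with ⟨h1, h2⟩ | ⟨p, s, hs0, hs, hp, hG, h1, h2⟩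
  · rwa [h1, h2, sub_self, abs_zero]
  rw [earlyVisit, mem_union, not_or] at hearly
  obtain ⟨he1, he2⟩ := hearly
  have he1' : ((t + θ * t : ℝ≥0) : ℝ≥0∞) < Gam γ ω δ' := not_le.1 he1
  have he2' : ∀ x ≤ M, ((t + θ * t : ℝ≥0) : ℝ≥0∞) < GamLeft γ ω (eventTime ω (x, 0)) := by
    intro x hx
    refine not_le.1 fun hc => he2 (mem_iUnion₂.2 ⟨x, ?_, hc⟩)
    simpa using hx
  have hgap' : δ' < ω (Sum.inl (p.1, p.2 + 1)) :=
    not_le.1 fun hc => hgap (mem_iUnion.2 ⟨p, hp, hc⟩)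
  have htime : ∀ v : Icc (0 : ℝ≥0) (θ - s),
      t * (1 + s) ≤ t * (1 + s + v) ∧ t * (1 + s + v) ≤ t + θ * t := by
    rintro ⟨v, hv0, hv⟩
    refine ⟨mul_le_mul_right le_self_add t, ?_⟩
    calc t * (1 + s + v) ≤ t * (1 + s + (θ - s)) := by gcongr
      _ = t * (1 + (s + (θ - s))) := by rw [add_assoc]
      _ = t + θ * t := by rw [add_tsub_cancel_of_le hs.le]; ring
  set η := piece (rescale t (kPath γ ω)) (1 + s) (θ - s) with hη
  have hval : ∀ v, η.1 v = kState γ ω (t * (1 + s + v)) := fun v => h.kPath_apply _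
  have hlow : ∀ x ≤ M, ∀ v, η.1 v ≠ (x : State) := by
    intro x hx v hc
    rw [hval, kState_eq_coe_iff h.inj] at hc
    obtain ⟨j, hj⟩ := hc
    have hle : GamLeft γ ω (eventTime ω (x, 0)) ≤ GamLeft γ ω (eventTime ω (x, j)) :=
      gamLeft_mono γ ω ((eventTime_strictMono h.pos x).monotone (Nat.zero_le j))
    have hle2 : ((t * (1 + s + v) : ℝ≥0) : ℝ≥0∞) ≤ (t + θ * t : ℝ≥0) :=
      ENNReal.coe_le_coe.2 (htime v).2
    exact absurd (he2' x hx) (not_lt.2 (hle.trans (hj.1.trans hle2)))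
  have hself : ∀ v, η.1 v ≠ (p.1 : State) := by
    intro v hc
    rw [hval, kState_eq_coe_iff h.inj] at hc
    obtain ⟨j, hj⟩ := hc
    have hle1 : ((t * (1 + s) : ℝ≥0) : ℝ≥0∞) ≤ (t * (1 + s + v) : ℝ≥0) :=
      ENNReal.coe_le_coe.2 (htime v).1
    have hle2 : ((t * (1 + s + v) : ℝ≥0) : ℝ≥0∞) ≤ (t + θ * t : ℝ≥0) :=
      ENNReal.coe_le_coe.2 (htime v).2
    -- Excursions to the same state with index up to p.2 are over by the exit time. Later ones start
    -- after local time δ', since their event time is at least the gap following p, hence after t +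
    -- θ t.
    rcases le_or_gt j p.2 with hjp | hjp
    · have : eventTime ω (p.1, j) ≤ eventTime ω p :=
        (eventTime_strictMono h.pos p.1).monotone hjp
      have h3 := hj.2.trans_le (gam_mono γ ω this)
      rw [hG] at h3
      exact absurd h3 (not_lt.2 hle1)
    · have h3 : ω (Sum.inl (p.1, p.2 + 1)) ≤ eventTime ω (p.1, j) :=
        clock_le_eventTime (p := (p.1, j)) h.pos hjp
      have h4 := he1'.trans_le (gam_le_gamLeft γ ω (hgap'.trans_le h3))
      exact absurd h4 (not_lt.2 (hj.1.trans hle2))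
  -- The path avoids both p.1 and 1, so the random state is exchanged for the fixed state 1.
  rw [h1, h2, hΦ.psi_eq θ s hs0 hs 1,
    hΦ.homogeneous θ s hs0 hs p.1 1 η hself (hlow 1 one_le)]
  refine hcont s η hs0 hs fun v => ?_
  have hd : ∀ y : State, y = η.1 v → d y OnePoint.infty < δ := by
    intro y hy
    induction y using OnePoint.rec with
    | infty => simpa [d] using hδ
    | coe y =>
      have hyM : M < y := not_le.1 fun hc => hlow y hc v hy.symm
      have : d (y : State) OnePoint.infty = ((y : ℕ) : ℝ)⁻¹ := by
        simp [d, KProc.inv]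
      rw [this]
      exact hM y hyM
  exact hd _ rfl

end

/-! ### The limit of the surrogate -/

section Limit

variable {Φ : ℝ≥0 → ℝ≥0 → CPath → ℝ} {Ψ₁ : ℝ → ℝ}
  {Ξ : (θ : ℝ≥0) → ℕ+ → (s : ℝ≥0) → Seg (θ - s) → ℝ} {Ψ₂ : ℝ → ℝ → ℝ}
  {γ : ℕ+ → ℝ} {t θ : ℝ≥0} {Λ : ℝ → ℝ}

/-- The probability that the excursion containing `t` lasts beyond `t + s t`. -/
def survivalProb (γ : ℕ+ → ℝ) (t : ℝ≥0) (s : ℝ) : ℝ := ∫ ω, survival γ t s ω ∂clockMeasure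

lemma integrable_survival (γ : ℕ+ → ℝ) (t : ℝ≥0) (s : ℝ) :
    Integrable (survival γ t s) clockMeasure :=
  Integrable.of_bound ((measurable_survival γ t).comp measurable_prodMk_left).aestronglyMeasurable 1
    (Eventually.of_forall fun ω => abs_survival_le γ t s ω)

lemma stronglyMeasurable_survivalProb (γ : ℕ+ → ℝ) (t : ℝ≥0) :
    StronglyMeasurable (survivalProb γ t) :=
  (measurable_survival γ t).stronglyMeasurable.integral_prod_right

lemma abs_survivalProb_le (γ : ℕ+ → ℝ) (t : ℝ≥0) (s : ℝ) : |survivalProb γ t s| ≤ 1 := by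
  have := norm_integral_le_of_norm_le_const (μ := clockMeasure) (f := survival γ t s) (C := 1)
    (Eventually.of_forall fun ω => abs_survival_le γ t s ω)
  simpa [survivalProb] using this

lemma expect_noJump (hγ : ∀ x, 0 < γ x) (hsum : Summable γ) (ht : 0 < t) (s : ℝ≥0) :
    expect γ (noJump t (s * t)) = survivalProb γ t s := by
  classical
  refine integral_congr_ae ?_
  filter_upwards [ae_isGoodAt hγ hsum ht s] with ω hω
  rw [hω.noJump_eq hγ, survival]
  refine if_congr ?_ rfl rfl
  rw [← ENNReal.ofReal_coe_nnreal]
  push_cast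
  rfl

lemma tendsto_survivalProb (hγ : ∀ x, 0 < γ x) (hsum : Summable γ)
    (hΛ : ∀ θ : ℝ≥0, 0 < θ →
      Tendsto (fun t : ℝ≥0 => expect γ (noJump t (θ * t))) (𝓝[>] 0) (𝓝 (Λ θ)))
    {s : ℝ} (hs : 0 < s) : Tendsto (fun t : ℝ≥0 => survivalProb γ t s) (𝓝[>] 0) (𝓝 (Λ s)) := by
  have h := hΛ s.toNNReal (Real.toNNReal_pos.2 hs)
  rw [Real.coe_toNNReal s hs.le] at h
  refine h.congr' ?_
  filter_upwards [self_mem_nhdsWithin] with t ht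
  rw [expect_noJump hγ hsum ht, Real.coe_toNNReal s hs.le]

lemma integrable_mul_survival {g : ℝ → ℝ} {θ : ℝ} (hg : IntervalIntegrable g volume 0 θ) :
    Integrable (Function.uncurry fun (s : ℝ) ω => g s * survival γ t s ω)
      ((volume.restrict (uIoc 0 θ)).prod clockMeasure) := by
  have h1 : Integrable g (volume.restrict (uIoc 0 θ)) := intervalIntegrable_iff.1 hg
  exact (h1.comp_fst clockMeasure).mul_bdd (c := 1)
    (measurable_survival γ t).aestronglyMeasurable
    (Eventually.of_forall fun q => abs_survival_le γ t q.1 q.2)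

lemma integrable_intervalIntegral_survival {g : ℝ → ℝ} {θ : ℝ} (hθ : 0 ≤ θ)
    (hg : IntervalIntegrable g volume 0 θ) :
    Integrable (fun ω => ∫ s in (0 : ℝ)..θ, g s * survival γ t s ω) clockMeasure := by
  have := (integrable_mul_survival (γ := γ) (t := t) hg).integral_prod_right
  simpa only [intervalIntegral.integral_of_le hθ, uIoc_of_le hθ, Function.uncurry_apply_pair]
    using this

lemma integrable_surrogate {θ : ℝ} (hΦ : IsTwoTimeFunctional Φ Ψ₁ Ξ Ψ₂) (hθ : 0 < θ) :
    Integrable (surrogate Ψ₁ Ψ₂ γ t θ) clockMeasure :=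
  ((integrable_const _).add ((integrable_survival γ t θ).const_mul _)).add
    (integrable_intervalIntegral_survival hθ.le (hΦ.psi_int θ hθ))

lemma integral_surrogate {θ : ℝ} (hΦ : IsTwoTimeFunctional Φ Ψ₁ Ξ Ψ₂) (hθ : 0 < θ) :
    ∫ ω, surrogate Ψ₁ Ψ₂ γ t θ ω ∂clockMeasure
      = Ψ₂ 0 θ + (Ψ₁ θ - Ψ₂ θ θ) * survivalProb γ t θ
        + ∫ s in (0 : ℝ)..θ, deriv (fun r => Ψ₂ r θ) s * survivalProb γ t s := by
  have hi := (integrable_survival γ t θ).const_mul (Ψ₁ θ - Ψ₂ θ θ)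
  have hi' : Integrable (fun ω => Ψ₂ 0 θ + (Ψ₁ θ - Ψ₂ θ θ) * survival γ t θ ω) clockMeasure :=
    (integrable_const _).add hi
  refine (integral_add hi' (integrable_intervalIntegral_survival hθ.le (hΦ.psi_int θ hθ))).trans ?_
  rw [integral_add (integrable_const _) hi, integral_const_mul, integral_const, probReal_univ,
    one_smul, ← intervalIntegral_integral_swap (integrable_mul_survival (hΦ.psi_int θ hθ))]
  simp only [integral_const_mul, survivalProb]

/-- Λ is an arbitrary function, measurable on (0, θ] because it is there the pointwise limit of the
survival probabilities. -/
lemma aestronglyMeasurable_limit (hγ : ∀ x, 0 < γ x) (hsum : Summable γ)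
    (hΛ : ∀ θ : ℝ≥0, 0 < θ →
      Tendsto (fun t : ℝ≥0 => expect γ (noJump t (θ * t))) (𝓝[>] 0) (𝓝 (Λ θ))) (θ : ℝ≥0) :
    AEStronglyMeasurable Λ (volume.restrict (uIoc 0 (θ : ℝ))) := by
  refine aestronglyMeasurable_of_tendsto_ae (𝓝[>] (0 : ℝ≥0)) (f := fun t => survivalProb γ t)
    (fun t => (stronglyMeasurable_survivalProb γ t).aestronglyMeasurable) ?_
  rw [ae_restrict_iff' measurableSet_uIoc]
  refine Eventually.of_forall fun s hs => ?_
  rw [uIoc_of_le (NNReal.coe_nonneg θ)] at hs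
  exact tendsto_survivalProb hγ hsum hΛ hs.1

lemma abs_limit_le (hγ : ∀ x, 0 < γ x) (hsum : Summable γ)
    (hΛ : ∀ θ : ℝ≥0, 0 < θ →
      Tendsto (fun t : ℝ≥0 => expect γ (noJump t (θ * t))) (𝓝[>] 0) (𝓝 (Λ θ)))
    {s : ℝ} (hs : 0 < s) : |Λ s| ≤ 1 :=
  le_of_tendsto' (tendsto_survivalProb hγ hsum hΛ hs).abs fun t => abs_survivalProb_le γ t s

lemma intervalIntegrable_mul_limit (hγ : ∀ x, 0 < γ x) (hsum : Summable γ)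
    (hΛ : ∀ θ : ℝ≥0, 0 < θ →
      Tendsto (fun t : ℝ≥0 => expect γ (noJump t (θ * t))) (𝓝[>] 0) (𝓝 (Λ θ)))
    {g : ℝ → ℝ} (hg : IntervalIntegrable g volume 0 θ) :
    IntervalIntegrable (fun s => g s * Λ s) volume 0 θ := by
  rw [intervalIntegrable_iff] at hg ⊢
  refine Integrable.mul_bdd (c := 1) hg (aestronglyMeasurable_limit hγ hsum hΛ θ) ?_
  rw [ae_restrict_iff' measurableSet_uIoc]
  refine Eventually.of_forall fun s hs => ?_
  rw [uIoc_of_le (NNReal.coe_nonneg θ)] at hs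
  exact abs_limit_le hγ hsum hΛ hs.1

lemma tendsto_integral_surrogate (hγ : ∀ x, 0 < γ x) (hsum : Summable γ)
    (hΛ : ∀ θ : ℝ≥0, 0 < θ →
      Tendsto (fun t : ℝ≥0 => expect γ (noJump t (θ * t))) (𝓝[>] 0) (𝓝 (Λ θ)))
    (hΦ : IsTwoTimeFunctional Φ Ψ₁ Ξ Ψ₂) (hθ : 0 < θ) :
    Tendsto (fun t : ℝ≥0 => ∫ ω, surrogate Ψ₁ Ψ₂ γ t θ ω ∂clockMeasure) (𝓝[>] 0)
      (𝓝 (Ψ₂ 0 θ + (Ψ₁ θ - Ψ₂ θ θ) * Λ θ +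
        ∫ s in (0 : ℝ)..θ, deriv (fun r => Ψ₂ r θ) s * Λ s)) := by
  have hθ' : (0 : ℝ) < θ := hθ
  have hg := hΦ.psi_int θ hθ'
  simp only [integral_surrogate hΦ hθ']
  refine ((tendsto_const_nhds.mul (tendsto_survivalProb hγ hsum hΛ hθ')).const_add _).add ?_
  refine intervalIntegral.tendsto_integral_filter_of_dominated_convergence
    (fun s => ‖deriv (fun r => Ψ₂ r θ) s‖) (Eventually.of_forall fun t => ?_)
    (Eventually.of_forall fun t => Eventually.of_forall fun s _ => ?_) hg.norm
    (Eventually.of_forall fun s hs => ?_)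
  · exact (intervalIntegrable_iff.1 hg).aestronglyMeasurable.mul
      (stronglyMeasurable_survivalProb γ t).aestronglyMeasurable
  · rw [norm_mul]
    exact mul_le_of_le_one_right (norm_nonneg _) (abs_survivalProb_le γ t s)
  · rw [uIoc_of_le (NNReal.coe_nonneg θ)] at hs
    exact tendsto_const_nhds.mul (tendsto_survivalProb hγ hsum hΛ hs.1)

/-! ### Comparison of the functional with its surrogate -/

lemma integrable_functional (hΦ : IsTwoTimeFunctional Φ Ψ₁ Ξ Ψ₂) (hγ : ∀ x, 0 < γ x)
    (hsum : Summable γ) (ht : 0 < t) (hθ : 0 < θ) :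
    Integrable (fun ω => Φ t (θ * t) (kPath γ ω)) clockMeasure := by
  obtain ⟨C, hC⟩ := hΦ.bounded θ hθ
  refine Integrable.of_bound ((hΦ.measurable t (θ * t) ht (by positivity)).comp_aemeasurable
    (aemeasurable_kPath hγ hsum)).aestronglyMeasurable (max |Ψ₁ θ| C) ?_
  filter_upwards [ae_isGoodAt hγ hsum ht θ] with ω hω
  rcases hω.cases hΦ hγ ht hθ with ⟨h1, -⟩ | ⟨p, s, hs0, hs, -, -, h1, -⟩
  · rw [h1]
    exact le_max_left _ _
  · rw [h1]
    exact (hC _ _ _ hs0 hs).trans (le_max_right _ _)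

lemma tendsto_expect_sub_surrogate (hΦ : IsTwoTimeFunctional Φ Ψ₁ Ξ Ψ₂) (hγ : ∀ x, 0 < γ x)
    (hsum : Summable γ) (hθ : 0 < θ) :
    Tendsto (fun t : ℝ≥0 => expect γ (Φ t (θ * t)) - ∫ ω, surrogate Ψ₁ Ψ₂ γ t θ ω ∂clockMeasure)
      (𝓝[>] 0) (𝓝 0) := by
  obtain ⟨C, hC⟩ := hΦ.bounded θ hθ
  have hC0 : 0 ≤ C := by
    obtain ⟨s, hs0, hs⟩ := exists_between hθ
    exact (abs_nonneg _).trans (hC 1 s (inftySeg _) hs0 hs)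
  rw [Metric.tendsto_nhds]
  intro ε hε
  obtain ⟨δ, hδ, hcont⟩ := hΦ.continuous θ hθ 1 (ε / 4) (by positivity)
  obtain ⟨M, hM⟩ : ∃ M : ℕ+, ∀ y : ℕ+, M < y → ((y : ℕ) : ℝ)⁻¹ < δ := by
    obtain ⟨n, hn⟩ := exists_nat_one_div_lt hδ
    refine ⟨n.succPNat, fun y hy => lt_of_le_of_lt ?_ hn⟩
    rw [one_div]
    have : n + 1 < (y : ℕ) := hy
    refine inv_anti₀ (by positivity) ?_
    exact_mod_cast this.le
  -- K bounds the difference on the bad event, and the added 1 keeps it positive. Each half of the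
  -- bad event has probability at most δ', so the error is at most ε/4 + 2 δ' K = 3ε/4.
  set K := 2 * C + 1 with hK
  have hKpos : 0 < K := by positivity
  set δ' := ε / (4 * K) with hδ'
  have hδ'pos : 0 < δ' := by positivity
  have hearly : Tendsto (fun t : ℝ≥0 => clockMeasure (earlyVisit γ M δ' (t + θ * t)))
      (𝓝[>] 0) (𝓝 0) := by
    refine (tendsto_earlyVisit hγ hsum M hδ'pos).comp
      (tendsto_nhdsWithin_of_tendsto_nhds_of_eventually_within _ ?_ ?_)
    · have : Continuous fun t : ℝ≥0 => t + θ * t := by fun_prop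
      have h := this.tendsto 0
      rw [mul_zero, add_zero] at h
      exact h.mono_left nhdsWithin_le_nhds
    · filter_upwards [self_mem_nhdsWithin] with t ht
      exact lt_of_lt_of_le (mem_Ioi.1 ht) le_self_add
  have hsmall : ∀ᶠ t : ℝ≥0 in 𝓝[>] 0,
      clockMeasure (earlyVisit γ M δ' (t + θ * t)) < ENNReal.ofReal δ' :=
    hearly.eventually (gt_mem_nhds (ENNReal.ofReal_pos.2 hδ'pos))
  filter_upwards [hsmall, self_mem_nhdsWithin] with t hts ht
  set B := earlyVisit γ M δ' (t + θ * t) ∪ shortGap γ δ' t with hB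
  have hBm : MeasurableSet B :=
    (measurableSet_earlyVisit _ _ _ _).union (measurableSet_shortGap _ _ _)
  have hPB : clockMeasure.real B ≤ 2 * δ' := by
    have h1 : clockMeasure B ≤ ENNReal.ofReal (2 * δ') := by
      rw [two_mul, ENNReal.ofReal_add hδ'pos.le hδ'pos.le]
      refine (measure_union_le _ _).trans (add_le_add hts.le ?_)
      refine (clockMeasure_shortGap_le γ δ' t).trans ?_
      rw [expMeasure_Iic hδ'pos.le]
      -- 1 - exp(-δ') ≤ δ'.
      exact ENNReal.ofReal_le_ofReal (by linarith [Real.add_one_le_exp (-δ')])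
    exact ENNReal.toReal_le_of_le_ofReal (by positivity) h1
  have hbound : ∀ᵐ ω ∂clockMeasure,
      ‖Φ t (θ * t) (kPath γ ω) - surrogate Ψ₁ Ψ₂ γ t θ ω‖
        ≤ ε / 4 + B.indicator (fun _ => K) ω := by
    filter_upwards [ae_isGoodAt hγ hsum ht θ] with ω hω
    by_cases hωB : ω ∈ B
    · rw [indicator_of_mem hωB, Real.norm_eq_abs]
      have := hω.abs_sub_surrogate_le hΦ hγ ht hθ hC0 hC
      linarith
    · rw [indicator_of_notMem hωB, add_zero, Real.norm_eq_abs]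
      rw [hB, mem_union, not_or] at hωB
      exact (hω.abs_sub_surrogate_lt hΦ hγ ht hθ (by positivity) hM hδ hcont hωB.1 hωB.2).le
  have hint : Integrable (fun ω => ε / 4 + B.indicator (fun _ => K) ω) clockMeasure :=
    (integrable_const _).add ((integrable_const K).indicator hBm)
  rw [dist_zero_right, expect,
    ← integral_sub (integrable_functional hΦ hγ hsum ht hθ) (integrable_surrogate hΦ (by exact_mod_cast hθ))]
  refine (norm_integral_le_of_norm_le hint hbound).trans_lt ?_
  rw [integral_add (integrable_const _) ((integrable_const K).indicator hBm), integral_const,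
    integral_indicator_const K hBm, probReal_univ, one_smul, smul_eq_mul]
  have h1 : clockMeasure.real B * K ≤ 2 * δ' * K := by gcongr
  have h2 : 2 * δ' * K = ε / 2 := by
    rw [hδ']; field_simp; norm_num
  linarith

end Limit

end KProc

end

open KProc in
theorem corollary5p15 (γ : ℕ+ → ℝ) (hγ : ∀ x, 0 < γ x) (hsum : Summable γ)
    (Λ : ℝ → ℝ)
    (hΛ : ∀ θ : ℝ≥0, 0 < θ →
      Tendsto (fun t : ℝ≥0 => expect γ (noJump t (θ * t))) (𝓝[>] 0) (𝓝 (Λ θ)))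
    (Φ : ℝ≥0 → ℝ≥0 → CPath → ℝ) (Ψ₁ : ℝ → ℝ)
    (Ξ : (θ : ℝ≥0) → ℕ+ → (s : ℝ≥0) → Seg (θ - s) → ℝ) (Ψ₂ : ℝ → ℝ → ℝ)
    (hΦ : IsTwoTimeFunctional Φ Ψ₁ Ξ Ψ₂) (θ : ℝ≥0) (hθ : 0 < θ) :
    (∀ t : ℝ≥0, 0 < t → Integrable (fun ω => Φ t (θ * t) (kPath γ ω)) clockMeasure) ∧
    IntervalIntegrable (fun s => deriv (fun r => Ψ₂ r θ) s * Λ s) volume 0 θ ∧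
    Tendsto (fun t : ℝ≥0 => expect γ (Φ t (θ * t))) (𝓝[>] 0)
      (𝓝 (Ψ₂ 0 θ + (Ψ₁ θ - Ψ₂ θ θ) * Λ θ +
        ∫ s in (0 : ℝ)..θ, deriv (fun r => Ψ₂ r θ) s * Λ s)) := by
  refine ⟨fun t ht => integrable_functional hΦ hγ hsum ht hθ,
    intervalIntegrable_mul_limit hγ hsum hΛ (hΦ.psi_int θ hθ), ?_⟩
  simpa using (tendsto_expect_sub_surrogate hΦ hγ hsum hθ).add
    (tendsto_integral_surrogate hγ hsum hΛ hΦ hθ)
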